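/- **Resolved conflicts and ambiguities imply incoherencies.** *Setting.* A statement over a node set $\mathbf X$ is a tuple $(X,Y,\mathbf S)$ with $X\neq Y$ in $\mathbf X$ and $\mathbf S\subseteq\mathbf X\setminus\{X,Y\}$ finite. For a graph $\mathcal G$ let $\mathcal C^{sep}(\mathcal G)$ and $\mathcal C^{con}(\mathcal G)$ be the sets of statements with $X,Y$ separated, respectively connected, given $\mathbf S$ in $\mathcal G$ (d-separation for DAGs, m-separation for maximal ancestral graphs). Two graphs are Markov equivalent if they have the same separations. A run of a constraint-based method tests a set $\mathcal T=\mathcal T^{ind}\cup\mathcal T^{dep}$ of statements; those in $\mathcal T^{ind}$ were judged independent, those in $\mathcal T^{dep}$ dependent. No assumption is made on how these results came about. *PC-like methods.* Each of the following methods assumes a graph type, deletes an edge exactly when its end nodes test independent given some set, records that set, classifies unshielded triples, and then orients edges. The classification is standard (collider iff the middle node is not in the recorded separating set), conservative (collider/non-collider iff separating sets were found and the middle node is in none/all of them), or by majority (in fewer/more than half of them); the last two rules test and consult all subsets of the neighbours of either outer node, possibly together with the recorded set, and mark a triple as ambiguous if they reach no verdict. The order of tests and of orientation steps is arbitrary,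 not all applicable orientation rules need be applied, and an edge end on which both an arrowhead and a tail were attempted is a marked conflict. 1. PC and PC-stable, on finitely many nodes; graph type: DAGs. When the skeleton phase stops, any two adjacent $X,Y$ have tested dependent given every set of other neighbours of $X$, and of $Y$. Orientation: unshielded colliders and Meek's rules 1–3. 2. FCI, on finitely many nodes; graph type: maximal ancestral graphs (undirected edges allowed). A PC skeleton phase is followed by tests given all subsets of the Possible-D-SEP sets. Orientation: unshielded colliders and rules R1–R10. The conservative and majority rules also consult the recorded separating set. 3. PCMCI+, for finitely many time series with maximal lag $\tau$; graph type: stationary time series DAGs on the nodes (variable, time $\in\mathbb Z$) whose edges do not point backwards in time and have lag at most $\tau$. A first phase yields, for each node, a set $B$ of lagged conditions, leaving out only lagged nodes that tested independent of it. When the second phase stops, any two adjacent nodes $X_{t-s}, Y_t$ ($0\le s\le\tau$) have tested dependent given $\mathbf S\cup (B(Y_t)\setminus\{X_{t-s}\})\cup B(X_{t-s})$ for every set $\mathbf S$ of other contemporaneous neighbours of $Y_t$; the sets consulted for triples are of this form too. Orientation: time order, unshielded colliders and Meek's rules 1–3. An output graph without marks *describes* a graph $\mathcal H$ of the assumed type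 if it has the skeleton of $\mathcal H$, all its arrowheads and tails occur in $\mathcal H$, and it contains all arrowheads and tails shared by all graphs of the type that are Markov equivalent to $\mathcal H$ (as the CPDAG or PAG of $\mathcal H$ does). Its separations (connections) are the statements that are separated (connected) in every graph of the type that it describes. A *resolution* of a marked output is any output graph with the same skeleton and without marked conflicts or ambiguities that describes some graph of the assumed type. It is *incoherent* with the test results if $\mathcal T^{ind}\not\subseteq\mathcal C^{sep}$ or $\mathcal T^{dep}\not\subseteq\mathcal C^{con}$, with its separations $\mathcal C^{sep}$ and connections $\mathcal C^{con}$. *Claim.* Suppose that the output of a run of such a method has a marked orientation conflict or a marked ambiguity. Then (a) no graph $\mathcal G$ of the assumed graph type represents all the test results, i.e. none satisfies both $\mathcal T^{ind}\subseteq\mathcal C^{sep}(\mathcal G)$ and $\mathcal T^{dep}\subseteq\mathcal C^{con}(\mathcal G)$; (b) every resolution of the output is incoherent with the test results. -/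

import Mathlib

universe u

/-! ### Mixed graphs, ancestors, separation, graph types -/

/-- A graph with at most one edge per pair of nodes; every edge end carries an arrowhead or a tail.
`arrow x y` says that the edge `x, y` has an arrowhead at `y`; the end at `y` is a tail otherwise. -/
structure MixedGraph (V : Type u) where
  skel : SimpleGraph V
  arrow : V → V → Prop
  arrow_adj : ∀ x y, arrow x y → skel.Adj x y

namespace MixedGraph

variable {V : Type u}

/-- `x → y`. -/
def Dir (G : MixedGraph V) (x y : V) : Prop := G.arrow x y ∧ ¬ G.arrow y x

/-- `x — y`. -/
def Undir (G : MixedGraph V) (x y : V) : Prop :=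
  G.skel.Adj x y ∧ ¬ G.arrow x y ∧ ¬ G.arrow y x

/-- `x` is an ancestor of `y`, every node being an ancestor of itself. -/
def Anc (G : MixedGraph V) : V → V → Prop := Relation.ReflTransGen G.Dir

/-- `y` is a collider on the (sub)path `x, y, z`. -/
def ColliderAt (G : MixedGraph V) (x y z : V) : Prop := G.arrow x y ∧ G.arrow z y

/-- A path that is active (m-connecting) given `S`: each inner collider is an ancestor of a member
of `S` and no inner non-collider is in `S`. -/
def Active (G : MixedGraph V) (S : Finset V) {x y : V} (p : G.skel.Walk x y) : Prop :=
  p.IsPath ∧ ∀ i, i + 2 ≤ p.length →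
    (G.ColliderAt (p.getVert i) (p.getVert (i + 1)) (p.getVert (i + 2)) →
      ∃ s ∈ S, G.Anc (p.getVert (i + 1)) s) ∧
    (¬ G.ColliderAt (p.getVert i) (p.getVert (i + 1)) (p.getVert (i + 2)) →
      p.getVert (i + 1) ∉ S)

/-- m-separation, which is d-separation when `G` is a DAG. -/
def Sep (G : MixedGraph V) (x y : V) (S : Finset V) : Prop :=
  ¬ ∃ p : G.skel.Walk x y, G.Active S p

/-- Directed acyclic graphs. -/
def IsDAG (G : MixedGraph V) : Prop :=
  (∀ x y, G.skel.Adj x y → G.Dir x y ∨ G.Dir y x) ∧ ∀ x, ¬ Relation.TransGen G.Dir x x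

/-- Ancestral graphs: no directed and no almost directed cycle, and no arrowhead at a node that
has an undirected edge. -/
def IsAncestral (G : MixedGraph V) : Prop :=
  (∀ x y, G.arrow x y → ¬ G.Anc y x) ∧ ∀ x y z, G.Undir x y → ¬ G.arrow z y

/-- Maximal ancestral graphs: any two distinct non-adjacent nodes can be separated. -/
def IsMAG (G : MixedGraph V) : Prop :=
  G.IsAncestral ∧ ∀ x y, x ≠ y → ¬ G.skel.Adj x y →
    ∃ S : Finset V, x ∉ S ∧ y ∉ S ∧ G.Sep x y S

end MixedGraph

/-- The graph type of PC. -/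
def dags (V : Type u) : Set (MixedGraph V) := {G | G.IsDAG}

/-- The graph type of FCI. -/
def mags (V : Type u) : Set (MixedGraph V) := {G | G.IsMAG}

/-- The graph type of PCMCI+: stationary time series DAGs over the variables `I` with maximal lag
`τ`. The node `(i, t)` is variable `i` at time `t`. -/
def tsDags (I : Type u) (τ : ℕ) : Set (MixedGraph (I × ℤ)) :=
  {G | G.IsDAG ∧
    (∀ i j s t, G.arrow (i, s) (j, t) → s ≤ t ∧ t - s ≤ τ) ∧
    ∀ i j s t, G.arrow (i, s) (j, t) ↔ G.arrow (i, s + 1) (j, t + 1)}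

/-! ### Test results, output graphs, incoherence -/

/-- The set `𝒞` of statements `(X, Y, S)`. -/
def stmts (V : Type u) : Set (V × V × Finset V) :=
  {t | t.1 ≠ t.2.1 ∧ t.1 ∉ t.2.2 ∧ t.2.1 ∉ t.2.2}

/-- The tested statements and the test indicator (`true` means: tested independent). -/
structure TestLog (V : Type u) where
  tested : Set (V × V × Finset V)
  tested_subset : tested ⊆ stmts V
  indicator : V × V × Finset V → Bool

namespace TestLog

variable {V : Type u}

/-- `𝒯^ind`. -/
def ind (L : TestLog V) : Set (V × V × Finset V) := {t | t ∈ L.tested ∧ L.indicator t = true}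

/-- `𝒯^dep`. -/
def dep (L : TestLog V) : Set (V × V × Finset V) := {t | t ∈ L.tested ∧ L.indicator t = false}

/-- `x`, `y` were tested independent given `S` (the pair in either order). -/
def Ind (L : TestLog V) (x y : V) (S : Finset V) : Prop :=
  (x, y, S) ∈ L.ind ∨ (y, x, S) ∈ L.ind

/-- `x`, `y` were tested dependent given `S` (the pair in either order). -/
def Dep (L : TestLog V) (x y : V) (S : Finset V) : Prop :=
  (x, y, S) ∈ L.dep ∨ (y, x, S) ∈ L.dep

/-- `x`, `y` were tested given `S` (the pair in either order). -/
def Tested (L : TestLog V) (x y : V) (S : Finset V) : Prop :=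
  (x, y, S) ∈ L.tested ∨ (y, x, S) ∈ L.tested

end TestLog

namespace MixedGraph

variable {V : Type u}

/-- `𝒞^sep`. -/
def sepStmts (G : MixedGraph V) : Set (V × V × Finset V) :=
  {t | t ∈ stmts V ∧ G.Sep t.1 t.2.1 t.2.2}

/-- `𝒞^con`. -/
def conStmts (G : MixedGraph V) : Set (V × V × Finset V) :=
  {t | t ∈ stmts V ∧ ¬ G.Sep t.1 t.2.1 t.2.2}

/-- The graph represents all test results. -/
def Represents (G : MixedGraph V) (L : TestLog V) : Prop :=
  L.ind ⊆ G.sepStmts ∧ L.dep ⊆ G.conStmts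

/-- Markov equivalence. -/
def MarkovEquiv (G H : MixedGraph V) : Prop := G.sepStmts = H.sepStmts

end MixedGraph

/-- An output graph. `head x y` (`tail x y`): the algorithm put an arrowhead (a tail) at the end
`y` of the edge `x, y`. An end with neither is left undetermined; an end with both is a marked
orientation conflict. `ambiguous x y z`: the triple is marked as ambiguous. -/
structure OutGraph (V : Type u) where
  skel : SimpleGraph V
  head : V → V → Prop
  tail : V → V → Prop
  ambiguous : V → V → V → Prop

namespace OutGraph

variable {V : Type u}

/-- There is a marked orientation conflict. -/
def HasConflict (P : OutGraph V) : Prop := ∃ x y, P.skel.Adj x y ∧ P.head x y ∧ P.tail x y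

/-- There is a marked ambiguity. -/
def HasAmbiguity (P : OutGraph V) : Prop := ∃ x y z, P.ambiguous x y z

/-- `P` describes the Markov equivalence class of `H` in the graph type `𝒢`: it has the skeleton
of `H`, the ends it determines are as in `H`, and it determines at least the ends on which the
class agrees. The CPDAG (PAG) of `H` and `H` itself are the two extremes. -/
def Describes (𝒢 : Set (MixedGraph V)) (P : OutGraph V) (H : MixedGraph V) : Prop :=
  P.skel = H.skel ∧ ∀ x y, P.skel.Adj x y →
    (P.head x y → H.arrow x y) ∧ (P.tail x y → ¬ H.arrow x y) ∧
    ((∀ H' ∈ 𝒢, H'.MarkovEquiv H → H'.arrow x y) → P.head x y) ∧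
    ((∀ H' ∈ 𝒢, H'.MarkovEquiv H → ¬ H'.arrow x y) → P.tail x y)

/-- `R` is a resolution of the output `P`: an output graph on the same skeleton without marked
conflicts or ambiguities that describes an equivalence class of the graph type. No orientation of
`P` has to be kept. -/
def IsResolution (𝒢 : Set (MixedGraph V)) (P R : OutGraph V) : Prop :=
  R.skel = P.skel ∧ ¬ R.HasConflict ∧ ¬ R.HasAmbiguity ∧ ∃ H ∈ 𝒢, R.Describes 𝒢 H

/-- Separations in an output graph: those of the graphs of the type that it describes. -/
def sepStmts (𝒢 : Set (MixedGraph V)) (R : OutGraph V) : Set (V × V × Finset V) :=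
  {t | t ∈ stmts V ∧ ∀ H ∈ 𝒢, R.Describes 𝒢 H → t ∈ H.sepStmts}

/-- Connections in an output graph. -/
def conStmts (𝒢 : Set (MixedGraph V)) (R : OutGraph V) : Set (V × V × Finset V) :=
  {t | t ∈ stmts V ∧ ∀ H ∈ 𝒢, R.Describes 𝒢 H → t ∈ H.conStmts}

/-- Incoherence of an output graph with the test results. -/
def Incoherent (𝒢 : Set (MixedGraph V)) (R : OutGraph V) (L : TestLog V) : Prop :=
  ¬ L.ind ⊆ R.sepStmts 𝒢 ∨ ¬ L.dep ⊆ R.conStmts 𝒢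

end OutGraph

/-! ### Classification of unshielded triples -/

/-- `x, y, z` is an unshielded triple of the skeleton. -/
def Unshielded {V : Type u} (C : SimpleGraph V) (x y z : V) : Prop :=
  C.Adj x y ∧ C.Adj y z ∧ x ≠ z ∧ ¬ C.Adj x z

/-- How unshielded triples are classified. -/
inductive TripleRule
  | standard
  | conservative
  | majority

namespace TripleRule

variable {V : Type u}

/-- The separating sets of `x`, `z` that are consulted. The standard rule looks at the recorded
separating set only. The other two look at all candidate sets given which `x`, `z` tested
independent, and, if `useSep`, at the recorded separating set as well. -/
def consulted (rule : TripleRule) (useSep : Bool) (L : TestLog V) (sep : V → V → Finset V)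
    (cand : V → V → Set (Finset V)) (x z : V) : Set (Finset V) :=
  match rule with
  | standard => {sep x z}
  | _ => {S | L.Ind x z S ∧ (S ∈ cand x z ∨ (useSep = true ∧ S = sep x z))}

/-- The consulted sets `𝒮` make `y` a collider. -/
def SaysCollider (rule : TripleRule) (𝒮 : Set (Finset V)) (y : V) : Prop :=
  match rule with
  | majority => 2 * {S | S ∈ 𝒮 ∧ y ∈ S}.ncard < 𝒮.ncard
  | _ => 𝒮.Nonempty ∧ ∀ S ∈ 𝒮, y ∉ S

/-- The consulted sets `𝒮` make `y` a non-collider. -/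
def SaysNoncollider (rule : TripleRule) (𝒮 : Set (Finset V)) (y : V) : Prop :=
  match rule with
  | majority => 𝒮.ncard < 2 * {S | S ∈ 𝒮 ∧ y ∈ S}.ncard
  | _ => 𝒮.Nonempty ∧ ∀ S ∈ 𝒮, y ∈ S

end TripleRule

/-- Candidate separating sets of `x`, `z` among the neighbours of `x` or those of `z`. -/
def nbrCand {V : Type u} (C : SimpleGraph V) (x z : V) : Set (Finset V) :=
  {S | (∀ s ∈ S, C.Adj x s) ∨ ∀ s ∈ S, C.Adj z s}

/-! ### PC -/

/-- The orientations `x → y` that PC can attempt: unshielded colliders and Meek's rules. Edges that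
already carry an orientation may be oriented again; this is how conflicts arise. `pre` are
orientations known beforehand, `col` and `noncol` the classified unshielded triples. -/
inductive MeekDerived {V : Type u} (C : SimpleGraph V) (pre : V → V → Prop)
    (col noncol : V → V → V → Prop) : V → V → Prop
  | pre (x y : V) : pre x y → MeekDerived C pre col noncol x y
  | colLeft (x y z : V) : col x y z → MeekDerived C pre col noncol x y
  | colRight (x y z : V) : col x y z → MeekDerived C pre col noncol z y
  | r1 (x y z : V) : MeekDerived C pre col noncol x y → noncol x y z →
      MeekDerived C pre col noncol y z
  | r2 (x y z : V) : MeekDerived C pre col noncol x y → MeekDerived C pre col noncol y z →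
      C.Adj x z → MeekDerived C pre col noncol x z
  | r3 (x y w z : V) : noncol y x w → C.Adj x z → MeekDerived C pre col noncol y z →
      MeekDerived C pre col noncol w z → MeekDerived C pre col noncol x z

/-- The orientation phase for DAGs: `D` is the set of orientations attempted. It contains the
known ones and those of all unshielded colliders; which further applicable rules are applied,
and in which order, is left to the implementation. -/
def MeekPhase {V : Type u} (pre : V → V → Prop) (col noncol : V → V → V → Prop)
    (out : OutGraph V) : Prop :=
  ∃ D : V → V → Prop,
    (∀ x y, pre x y → D x y) ∧
    (∀ x y z, col x y z → D x y ∧ D z y) ∧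
    (∀ x y, D x y → MeekDerived out.skel pre col noncol x y) ∧
    (∀ x y, out.head x y ↔ D x y) ∧
    ∀ x y, out.tail x y ↔ D y x

/-- `out` is an output of PC (with any order of the tests, so also of PC-stable) with test results
`L` and recorded separating sets `sep`. An edge is deleted exactly when an independence is found,
and PC stops when, for each edge `x, y` left, `x`, `y` tested dependent given each set of other
neighbours of `x`, and of `y`. -/
structure PCRun {V : Type u} (rule : TripleRule) (useSep : Bool) (L : TestLog V)
    (sep : V → V → Finset V) (out : OutGraph V) : Prop where
  sep_symm : ∀ x y, sep x y = sep y x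
  deleted : ∀ x y, x ≠ y → ¬ out.skel.Adj x y → L.Ind x y (sep x y)
  kept : ∀ x y, out.skel.Adj x y → ∀ S, ¬ L.Ind x y S
  exhausted : ∀ x y, out.skel.Adj x y → ∀ S : Finset V,
    (∀ s ∈ S, out.skel.Adj x s ∧ s ≠ y) → L.Dep x y S
  consult : rule ≠ .standard → ∀ x y z, Unshielded out.skel x y z →
    ∀ S ∈ nbrCand out.skel x z, L.Tested x z S
  orient : MeekPhase (fun _ _ => False)
    (fun x y z => Unshielded out.skel x y z ∧
      rule.SaysCollider (rule.consulted useSep L sep (nbrCand out.skel) x z) y)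
    (fun x y z => Unshielded out.skel x y z ∧
      rule.SaysNoncollider (rule.consulted useSep L sep (nbrCand out.skel) x z) y) out
  ambiguous_iff : ∀ x y z, out.ambiguous x y z ↔ Unshielded out.skel x y z ∧
    ¬ rule.SaysCollider (rule.consulted useSep L sep (nbrCand out.skel) x z) y ∧
    ¬ rule.SaysNoncollider (rule.consulted useSep L sep (nbrCand out.skel) x z) y

/-! ### FCI -/

/-- The two determinate marks of an edge end. -/
inductive EndMark
  | arrow
  | tail

/-- All consecutive triples of the walk are classified as (unshielded) non-colliders. -/
def UncoveredNoncol {V : Type u} {C : SimpleGraph V} (noncol : V → V → V → Prop) {x y : V}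
    (p : C.Walk x y) : Prop :=
  ∀ i, i + 2 ≤ p.length → noncol (p.getVert i) (p.getVert (i + 1)) (p.getVert (i + 2))

open EndMark in
/-- The end marks that FCI can attempt to set, by the collider rule and the orientation rules
R1 to R10; `FCIDerived .. m x y` puts the mark `m` at the end `y` of the edge `x, y`. As
for PC, ends may be marked again. The rules ask for unshielded triples that do not carry the marks
of a collider; here these are the ones classified as non-colliders. -/
inductive FCIDerived {V : Type u} (C : SimpleGraph V) (sep : V → V → Finset V)
    (col noncol : V → V → V → Prop) : EndMark → V → V → Prop
  | colLeft (a b c : V) : col a b c → FCIDerived C sep col noncol arrow a b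
  | colRight (a b c : V) : col a b c → FCIDerived C sep col noncol arrow c b
  | r1Tail (a b c : V) : FCIDerived C sep col noncol arrow a b → noncol a b c →
      FCIDerived C sep col noncol tail c b
  | r1Arrow (a b c : V) : FCIDerived C sep col noncol arrow a b → noncol a b c →
      FCIDerived C sep col noncol arrow b c
  -- `a → b *→ c`
  | r2Left (a b c : V) : FCIDerived C sep col noncol tail b a →
      FCIDerived C sep col noncol arrow a b → FCIDerived C sep col noncol arrow b c →
      C.Adj a c → FCIDerived C sep col noncol arrow a c
  -- `a *→ b → c`
  | r2Right (a b c : V) : FCIDerived C sep col noncol arrow a b →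
      FCIDerived C sep col noncol tail c b → FCIDerived C sep col noncol arrow b c →
      C.Adj a c → FCIDerived C sep col noncol arrow a c
  | r3 (a b c d : V) : FCIDerived C sep col noncol arrow a b →
      FCIDerived C sep col noncol arrow c b → noncol a d c → C.Adj d b →
      FCIDerived C sep col noncol arrow d b
  -- `p` followed by `c` is a discriminating path from `q` to `c` for `b`
  | r4In (q b c : V) (p : C.Walk q b) (m : EndMark) (x y : V) : p.IsPath → c ∉ p.support →
      2 ≤ p.length → C.Adj b c → ¬ C.Adj q c →
      (∀ i, i + 2 ≤ p.length →
        FCIDerived C sep col noncol arrow (p.getVert i) (p.getVert (i + 1))) →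
      (∀ i, i + 2 ≤ p.length →
        FCIDerived C sep col noncol arrow (p.getVert (i + 2)) (p.getVert (i + 1))) →
      (∀ i, i + 2 ≤ p.length → FCIDerived C sep col noncol tail c (p.getVert (i + 1))) →
      (∀ i, i + 2 ≤ p.length → FCIDerived C sep col noncol arrow (p.getVert (i + 1)) c) →
      b ∈ sep q c →
      (m = tail ∧ x = c ∧ y = b) ∨ (m = arrow ∧ x = b ∧ y = c) →
      FCIDerived C sep col noncol m x y
  | r4Out (q b c : V) (p : C.Walk q b) (x y : V) : p.IsPath → c ∉ p.support →
      2 ≤ p.length → C.Adj b c → ¬ C.Adj q c →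
      (∀ i, i + 2 ≤ p.length →
        FCIDerived C sep col noncol arrow (p.getVert i) (p.getVert (i + 1))) →
      (∀ i, i + 2 ≤ p.length →
        FCIDerived C sep col noncol arrow (p.getVert (i + 2)) (p.getVert (i + 1))) →
      (∀ i, i + 2 ≤ p.length → FCIDerived C sep col noncol tail c (p.getVert (i + 1))) →
      (∀ i, i + 2 ≤ p.length → FCIDerived C sep col noncol arrow (p.getVert (i + 1)) c) →
      b ∉ sep q c →
      (x = p.penultimate ∧ y = b) ∨ (x = b ∧ y = p.penultimate) ∨
        (x = b ∧ y = c) ∨ (x = c ∧ y = b) →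
      FCIDerived C sep col noncol arrow x y
  -- an uncovered cycle, made of `p` and the edge `a, b`, without colliders
  | r5 (a b : V) (p : C.Walk a b) (x y : V) : p.IsPath → C.Adj a b →
      UncoveredNoncol noncol p → noncol (p.getVert 1) a b → noncol a b p.penultimate →
      s(x, y) ∈ p.edges ∨ s(x, y) = s(a, b) →
      FCIDerived C sep col noncol tail x y
  -- `a — b -* c`
  | r6 (a b c : V) : FCIDerived C sep col noncol tail a b → FCIDerived C sep col noncol tail b a →
      C.Adj b c → FCIDerived C sep col noncol tail c b
  | r7 (a b c : V) : FCIDerived C sep col noncol tail b a → noncol a b c →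
      FCIDerived C sep col noncol tail c b
  -- `a -* b → c` and `a *→ c`, with a tail at `a` on the first edge
  | r8 (a b c : V) : FCIDerived C sep col noncol tail b a →
      FCIDerived C sep col noncol tail c b → FCIDerived C sep col noncol arrow b c →
      FCIDerived C sep col noncol arrow a c → FCIDerived C sep col noncol tail c a
  | r9 (a c : V) (p : C.Walk a c) : FCIDerived C sep col noncol arrow a c → p.IsPath →
      UncoveredNoncol noncol p → noncol (p.getVert 1) a c →
      FCIDerived C sep col noncol tail c a
  -- `b → c ← d` and uncovered paths from `a` to `b` and from `a` to `d`
  | r10 (a b c d : V) (p : C.Walk a b) (q : C.Walk a d) :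
      FCIDerived C sep col noncol arrow a c →
      FCIDerived C sep col noncol tail c b → FCIDerived C sep col noncol arrow b c →
      FCIDerived C sep col noncol tail c d → FCIDerived C sep col noncol arrow d c →
      p.IsPath → q.IsPath → UncoveredNoncol noncol p → UncoveredNoncol noncol q →
      noncol (p.getVert 1) a (q.getVert 1) →
      FCIDerived C sep col noncol tail c a

/-- In the preliminary skeleton `C`, the collider rule puts an arrowhead at `y` on `x, y`. -/
def PrelimArrow {V : Type u} (C : SimpleGraph V) (sep : V → V → Finset V) (x y : V) : Prop :=
  ∃ z, Unshielded C x y z ∧ y ∉ sep x z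

/-- `v` is in Possible-D-SEP of `x`: there is a path from `x` to `v` each of whose consecutive
triples is a triangle or a collider. -/
def PossibleDSep {V : Type u} (C : SimpleGraph V) (sep : V → V → Finset V) (x v : V) : Prop :=
  x ≠ v ∧ ∃ p : C.Walk x v, p.IsPath ∧ ∀ i, i + 2 ≤ p.length →
    C.Adj (p.getVert i) (p.getVert (i + 2)) ∨
    (PrelimArrow C sep (p.getVert i) (p.getVert (i + 1)) ∧
      PrelimArrow C sep (p.getVert (i + 2)) (p.getVert (i + 1)))

/-- `out` is an output of FCI with test results `L` and recorded separating sets `sep`. A first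
phase finds the skeleton `C₁` as in PC; a second one tests the remaining edges given all subsets of
the Possible-D-SEP sets, computed from `C₁` and the collider rule; then all orientations start
afresh. -/
structure FCIRun {V : Type u} (rule : TripleRule) (L : TestLog V) (C₁ : SimpleGraph V)
    (sep : V → V → Finset V) (out : OutGraph V) : Prop where
  sep_symm : ∀ x y, sep x y = sep y x
  skel_le : out.skel ≤ C₁
  exhausted_first : ∀ x y, C₁.Adj x y → ∀ S : Finset V,
    (∀ s ∈ S, C₁.Adj x s ∧ s ≠ y) → L.Dep x y S
  deleted : ∀ x y, x ≠ y → ¬ out.skel.Adj x y → L.Ind x y (sep x y)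
  kept : ∀ x y, out.skel.Adj x y → ∀ S, ¬ L.Ind x y S
  exhausted : ∀ x y, out.skel.Adj x y → ∀ S : Finset V,
    (∀ s ∈ S, PossibleDSep C₁ sep x s ∧ s ≠ y) → L.Dep x y S
  consult : rule ≠ .standard → ∀ x y z, Unshielded out.skel x y z →
    ∀ S ∈ nbrCand out.skel x z, L.Tested x z S
  orient : ∃ A : EndMark → V → V → Prop,
    (∀ x y z, Unshielded out.skel x y z →
      rule.SaysCollider (rule.consulted true L sep (nbrCand out.skel) x z) y →
      A .arrow x y ∧ A .arrow z y) ∧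
    (∀ m x y, A m x y → FCIDerived out.skel sep
      (fun x y z => Unshielded out.skel x y z ∧
        rule.SaysCollider (rule.consulted true L sep (nbrCand out.skel) x z) y)
      (fun x y z => Unshielded out.skel x y z ∧
        rule.SaysNoncollider (rule.consulted true L sep (nbrCand out.skel) x z) y) m x y) ∧
    (∀ x y, out.head x y ↔ A .arrow x y) ∧
    ∀ x y, out.tail x y ↔ A .tail x y
  ambiguous_iff : ∀ x y z, out.ambiguous x y z ↔ Unshielded out.skel x y z ∧
    ¬ rule.SaysCollider (rule.consulted true L sep (nbrCand out.skel) x z) y ∧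
    ¬ rule.SaysNoncollider (rule.consulted true L sep (nbrCand out.skel) x z) y

/-! ### PCMCI+ -/

section PCMCI

variable {I : Type u}

/-- Shift by one time step. -/
def tsShift : I × ℤ ↪ I × ℤ :=
  ⟨fun v => (v.1, v.2 + 1), fun v w h => by
    rcases v with ⟨i, s⟩
    rcases w with ⟨j, t⟩
    simp only [Prod.mk.injEq, add_left_inj] at h
    exact Prod.ext h.1 h.2⟩

/-- `S'` is the conditioning set of the momentary conditional independence test of `x`, `y` with
contemporaneous conditions `S` and lagged conditions `B`. -/
def IsMCISet (B : I × ℤ → Finset (I × ℤ)) (x y : I × ℤ) (S S' : Finset (I × ℤ)) : Prop :=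
  (S' : Set (I × ℤ)) = ↑S ∪ (↑(B y) \ {x}) ∪ ↑(B x)

/-- Candidate separating sets of `x`, `z`. -/
def mciCand (C : SimpleGraph (I × ℤ)) (B : I × ℤ → Finset (I × ℤ)) (x z : I × ℤ) :
    Set (Finset (I × ℤ)) :=
  {S' | ∃ S : Finset (I × ℤ),
    (x.2 ≤ z.2 ∧ (∀ s ∈ S, C.Adj z s ∧ s.2 = z.2) ∧ IsMCISet B x z S S') ∨
    (z.2 ≤ x.2 ∧ (∀ s ∈ S, C.Adj x s ∧ s.2 = x.2) ∧ IsMCISet B z x S S')}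

/-- Unshielded triples with a contemporaneous edge and another edge that is contemporaneous or
lagged into the middle node. -/
def TsUnshielded (C : SimpleGraph (I × ℤ)) (x y z : I × ℤ) : Prop :=
  Unshielded C x y z ∧ ((x.2 ≤ y.2 ∧ z.2 = y.2) ∨ (z.2 ≤ y.2 ∧ x.2 = y.2))

/-- `out` is an output of PCMCI+ with maximal lag `τ`, test results `L`, lagged conditions `B` from
the first phase and recorded separating sets `sep`. A test of one lagged statement counts as a test
of all its time shifts. -/
structure PCMCIPlusRun (τ : ℕ) (rule : TripleRule) (useSep : Bool) (L : TestLog (I × ℤ))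
    (B : I × ℤ → Finset (I × ℤ)) (sep : I × ℤ → I × ℤ → Finset (I × ℤ))
    (out : OutGraph (I × ℤ)) : Prop where
  tested_shift : ∀ x y S, (x, y, S) ∈ L.tested ↔
    (tsShift x, tsShift y, S.map tsShift) ∈ L.tested
  indicator_shift : ∀ x y S, L.indicator (x, y, S) =
    L.indicator (tsShift x, tsShift y, S.map tsShift)
  skel_shift : ∀ x y, out.skel.Adj x y ↔ out.skel.Adj (tsShift x) (tsShift y)
  skel_lag : ∀ x y, out.skel.Adj x y → |y.2 - x.2| ≤ (τ : ℤ)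
  lagged_shift : ∀ y, B (tsShift y) = (B y).map tsShift
  lagged_mem : ∀ x y, x ∈ B y → x.2 < y.2 ∧ y.2 - x.2 ≤ τ
  lagged_removed : ∀ x y : I × ℤ, x.2 < y.2 → y.2 - x.2 ≤ τ → x ∉ B y → ∃ S, L.Ind x y S
  lagged_adj : ∀ x y, out.skel.Adj x y → x.2 < y.2 → x ∈ B y
  sep_symm : ∀ x y, sep x y = sep y x
  deleted : ∀ x y, x ≠ y → |y.2 - x.2| ≤ (τ : ℤ) → ¬ out.skel.Adj x y → L.Ind x y (sep x y)
  kept : ∀ x y, out.skel.Adj x y → ∀ S, ¬ L.Ind x y S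
  exhausted : ∀ x y, out.skel.Adj x y → x.2 ≤ y.2 → ∀ S S' : Finset (I × ℤ),
    (∀ s ∈ S, out.skel.Adj y s ∧ s.2 = y.2 ∧ s ≠ x) → IsMCISet B x y S S' → L.Dep x y S'
  consult : rule ≠ .standard → ∀ x y z, TsUnshielded out.skel x y z →
    ∀ S ∈ mciCand out.skel B x z, L.Tested x z S
  orient : MeekPhase (fun x y => out.skel.Adj x y ∧ x.2 < y.2)
    (fun x y z => TsUnshielded out.skel x y z ∧
      rule.SaysCollider (rule.consulted useSep L sep (mciCand out.skel B) x z) y)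
    (fun x y z => TsUnshielded out.skel x y z ∧
      rule.SaysNoncollider (rule.consulted useSep L sep (mciCand out.skel B) x z) y) out
  ambiguous_iff : ∀ x y z, out.ambiguous x y z ↔ TsUnshielded out.skel x y z ∧
    ¬ rule.SaysCollider (rule.consulted useSep L sep (mciCand out.skel B) x z) y ∧
    ¬ rule.SaysNoncollider (rule.consulted useSep L sep (mciCand out.skel B) x z) y

end PCMCI

/-! ### PC-like methods -/

/-- `out` is the output, with marked conflicts and ambiguities, of a run of a PC-like method that
assumes the graph type `𝒢` and obtained the test results `L`. -/
inductive PCLikeOutput : {V : Type u} → Set (MixedGraph V) → TestLog V → OutGraph V → Prop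
  | pc {V : Type u} [Finite V] (rule : TripleRule) (useSep : Bool) (L : TestLog V)
      (sep : V → V → Finset V) (out : OutGraph V) :
      PCRun rule useSep L sep out → PCLikeOutput (dags V) L out
  | fci {V : Type u} [Finite V] (rule : TripleRule) (L : TestLog V) (C₁ : SimpleGraph V)
      (sep : V → V → Finset V) (out : OutGraph V) :
      FCIRun rule L C₁ sep out → PCLikeOutput (mags V) L out
  | pcmciPlus {I : Type u} [Finite I] (τ : ℕ) (rule : TripleRule) (useSep : Bool)
      (L : TestLog (I × ℤ)) (B : I × ℤ → Finset (I × ℤ)) (sep : I × ℤ → I × ℤ → Finset (I × ℤ))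
      (out : OutGraph (I × ℤ)) :
      PCMCIPlusRun τ rule useSep L B sep out → PCLikeOutput (tsDags I τ) L out

/-! ### Walks given by sequences of nodes -/

/-! Suppose a graph `G` of the assumed type represents all test results. Every independence found is
then a separation in `G`, so no edge of `G` is ever deleted. Conversely, two nodes that are not
adjacent in `G` are separated by a set that the method was bound to test, so no other edge survives,
and the output has the skeleton of `G`. For DAGs this set consists of the parents of a node that is
not an ancestor of the other (`IsDAG.sep_of_parents`). For time series, lagged conditions are added,
which are non-descendants (`exists_isMCISet_sep`). For maximal ancestral graphs the set is reached
by collider paths (`IsMAG.exists_sep_of_not_adj`), which keeps it inside Possible-D-SEP.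

A set separating the outer nodes of an unshielded triple contains the middle node exactly if that
node is a non-collider (`mem_iff_not_colliderAt_of_sep`). Hence all consulted sets agree, at least
one is consulted, and every rule reaches the verdict that is true in `G`: there is no ambiguity
(`TripleRule.says_of_represents`). From true verdicts the orientation rules derive only marks of
`G`, whatever their order (`MeekDerived.dir`, `FCIDerived.hasMark`), so no end receives both marks:
there is no conflict. This proves (a).

For (b), a resolution describes some `H` of the type. If it were coherent, its separations and
connections, which all hold in `H`, would make `H` represent the results, against (a). -/

theorem SimpleGraph.exists_walk_of_seq {V : Type u} (C : SimpleGraph V) (n : ℕ) (f : ℕ → V)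
    (h : ∀ i, i < n → C.Adj (f i) (f (i + 1))) :
    ∃ p : C.Walk (f 0) (f n), p.length = n ∧ ∀ i, i ≤ n → p.getVert i = f i := by
  induction n generalizing f with
  | zero => exact ⟨.nil, rfl, fun i hi => by obtain rfl : i = 0 := by omega
                                             rfl⟩
  | succ n ih =>
    obtain ⟨p, hp, hv⟩ := ih (fun i => f (i + 1)) fun i hi => h (i + 1) (by omega)
    refine ⟨.cons (h 0 (by omega)) p, by simp [hp], fun i hi => ?_⟩
    cases i with
    | zero => rfl
    | succ i => rw [SimpleGraph.Walk.getVert_cons_succ]; exact hv i (by omega)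

/-! ### Active sequences and first facts on separation. -/

namespace MixedGraph

variable {V : Type u} {G : MixedGraph V} {S : Finset V}

/-- `f 0, …, f n` is a walk on which each inner collider is an ancestor of a member of `S` and no
inner non-collider is in `S`. -/
def ActiveSeq (G : MixedGraph V) (S : Finset V) (n : ℕ) (f : ℕ → V) : Prop :=
  (∀ i, i < n → G.skel.Adj (f i) (f (i + 1))) ∧ ∀ i, i + 2 ≤ n →
    (G.ColliderAt (f i) (f (i + 1)) (f (i + 2)) → ∃ s ∈ S, G.Anc (f (i + 1)) s) ∧
    (¬ G.ColliderAt (f i) (f (i + 1)) (f (i + 2)) → f (i + 1) ∉ S)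

theorem ColliderAt.symm {x y z : V} (h : G.ColliderAt x y z) : G.ColliderAt z y x := ⟨h.2, h.1⟩

theorem colliderAt_comm {x y z : V} : G.ColliderAt x y z ↔ G.ColliderAt z y x :=
  ⟨ColliderAt.symm, ColliderAt.symm⟩

theorem not_sep_iff {x y : V} : ¬ G.Sep x y S ↔ ∃ (n : ℕ) (f : ℕ → V), f 0 = x ∧ f n = y ∧
    Set.InjOn f {i | i ≤ n} ∧ G.ActiveSeq S n f := by
  rw [Sep, not_not]
  constructor
  · rintro ⟨p, hp, h⟩
    exact ⟨p.length, p.getVert, p.getVert_zero, p.getVert_length, hp.getVert_injOn,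
      fun i hi => p.adj_getVert_succ hi, h⟩
  · rintro ⟨n, f, rfl, rfl, hinj, hadj, h⟩
    obtain ⟨p, hl, hv⟩ := G.skel.exists_walk_of_seq n f hadj
    refine ⟨p, ?_, fun i hi => ?_⟩
    · rw [← SimpleGraph.Walk.IsPath.getVert_injOn_iff]
      rw [hl]
      intro i hi j hj hij
      exact hinj hi hj (by rwa [hv i hi, hv j hj] at hij)
    · rw [hl] at hi
      rw [hv i (by omega), hv (i + 1) (by omega), hv (i + 2) hi]
      exact h i hi

theorem ActiveSeq.reverse {n : ℕ} {f : ℕ → V} (h : G.ActiveSeq S n f) :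
    G.ActiveSeq S n fun i => f (n - i) := by
  refine ⟨fun i hi => ?_, fun i hi => ?_⟩
  · have := h.1 (n - (i + 1)) (by omega)
    rw [show n - (i + 1) + 1 = n - i by omega] at this
    exact this.symm
  · have := h.2 (n - (i + 2)) (by omega)
    rw [show n - (i + 2) + 1 = n - (i + 1) by omega, show n - (i + 2) + 2 = n - i by omega,
      colliderAt_comm] at this
    exact this

theorem Sep.symm {x y : V} (h : G.Sep x y S) : G.Sep y x S := by
  by_contra hc
  obtain ⟨n, f, rfl, rfl, hinj, hf⟩ := not_sep_iff.1 hc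
  refine not_sep_iff.2 ⟨n, fun i => f (n - i), by simp, by simp, ?_, hf.reverse⟩ h
  intro i hi j hj hij
  have := hinj (show n - i ≤ n by omega) (show n - j ≤ n by omega) hij
  simp only [Set.mem_ofPred_eq] at hi hj
  omega

theorem not_adj_of_sep {x y : V} (h : G.Sep x y S) : ¬ G.skel.Adj x y := by
  intro hxy
  refine not_sep_iff.2 ⟨1, fun i => if i = 0 then x else y, by simp, by simp, ?_, ?_, ?_⟩ h
  · intro i hi j hj hij
    simp only [Set.mem_ofPred_eq] at hi hj
    have := hxy.ne
    grind
  · intro i hi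
    obtain rfl : i = 0 := by omega
    simpa using hxy
  · intro i hi
    omega

/-- Otherwise the path `x, y, z` would itself be active: a collider in `S` is its own ancestor in
`S`, and a non-collider outside `S` does not block. -/
theorem mem_iff_not_colliderAt_of_sep {x y z : V} (hxy : G.skel.Adj x y) (hyz : G.skel.Adj y z)
    (hxz : x ≠ z) (h : G.Sep x z S) : y ∈ S ↔ ¬ G.ColliderAt x y z := by
  by_contra hc
  refine not_sep_iff.2 ⟨2, fun i => if i = 0 then x else if i = 1 then y else z, by simp, by simp,
    ?_, ?_, ?_⟩ h
  · intro i hi j hj hij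
    simp only [Set.mem_ofPred_eq] at hi hj
    have := hxy.ne
    have := hyz.ne
    grind
  · intro i hi
    obtain rfl | rfl : i = 0 ∨ i = 1 := by omega
    · simpa using hxy
    · simpa using hyz
  · intro i hi
    obtain rfl : i = 0 := by omega
    simp only [zero_add, one_ne_zero, if_true, if_false, OfNat.ofNat_ne_zero, OfNat.ofNat_ne_one]
    by_cases hcol : G.ColliderAt x y z
    · have hy : y ∈ S := by tauto
      exact ⟨fun _ => ⟨y, hy, .refl⟩, fun hn => absurd hcol hn⟩
    · exact ⟨fun hn => absurd hn hcol, fun _ => by tauto⟩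

/-! ### Directed acyclic graphs -/

theorem IsDAG.not_anc (hG : G.IsDAG) {x y : V} (h : G.Dir x y) : ¬ G.Anc y x := fun ha =>
  hG.2 x (Relation.TransGen.head' h ha)

theorem IsDAG.dir_of_arrow (hG : G.IsDAG) {x y : V} (h : G.arrow x y) : G.Dir x y :=
  (hG.1 x y (G.arrow_adj x y h)).resolve_right fun h' => h'.2 h

theorem IsDAG.dir_of_not_arrow (hG : G.IsDAG) {x y : V} (h : G.skel.Adj x y)
    (hn : ¬ G.arrow y x) : G.Dir x y :=
  (hG.1 x y h).resolve_right fun h' => hn h'.1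

theorem IsDAG.not_anc_or_not_anc (hG : G.IsDAG) {x y : V} (h : x ≠ y) :
    ¬ G.Anc y x ∨ ¬ G.Anc x y := by
  by_contra! hc
  rcases Relation.ReflTransGen.cases_head hc.2 with rfl | ⟨z, hxz, hzy⟩
  · exact h rfl
  · exact hG.not_anc hxz (hzy.trans hc.1)

/-- A set of non-descendants of `y` that contains all parents of `y` separates `y` from every
other non-descendant. -/
theorem IsDAG.sep_of_parents (hG : G.IsDAG) {x y : V} (hanc : ¬ G.Anc y x)
    (hadj : ¬ G.skel.Adj x y) (hpa : ∀ a, G.Dir a y → a ∈ S) (hnd : ∀ s ∈ S, ¬ G.Anc y s) :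
    G.Sep x y S := by
  refine Sep.symm ?_
  by_contra hc
  obtain ⟨n, f, rfl, rfl, -, hf, hact⟩ := not_sep_iff.1 hc
  have hn0 : n ≠ 0 := by rintro rfl; exact hanc .refl
  have hn1 : n ≠ 1 := by
    rintro rfl
    exact hadj (hf 0 (by omega)).symm
  -- An edge into `f 0` would come from a parent, which lies in `S` and blocks the path as a
  -- non-collider.
  have hdir : G.Dir (f 0) (f 1) := by
    refine hG.dir_of_not_arrow (hf 0 (by omega)) fun har => ?_
    have hd := hG.dir_of_arrow har
    exact (hact 0 (by omega)).2 (fun hcol => hd.2 hcol.1) (hpa _ hd)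
  -- The path stays directed: its first collider would be a descendant of `f 0` with a descendant in
  -- `S`, against `hnd`. So the other end is a descendant of `f 0`.
  have key : ∀ j, j + 1 ≤ n → G.Dir (f j) (f (j + 1)) ∧ G.Anc (f 0) (f (j + 1)) := by
    intro j
    induction j with
    | zero => exact fun _ => ⟨hdir, .single hdir⟩
    | succ j ih =>
      intro hj
      obtain ⟨hd, ha⟩ := ih (by omega)
      have hd' : G.Dir (f (j + 1)) (f (j + 2)) := by
        refine hG.dir_of_not_arrow (hf (j + 1) (by omega)) fun har => ?_
        obtain ⟨s, hs, hanc'⟩ := (hact j (by omega)).1 ⟨hd.1, har⟩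
        exact hnd s hs (ha.trans hanc')
      exact ⟨hd', ha.tail hd'⟩
  have := (key (n - 1) (by omega)).2
  rw [show n - 1 + 1 = n by omega] at this
  exact hanc this

/-! ### Ancestral graphs -/

theorem IsAncestral.dir_of_arrow_of_not_arrow (hG : G.IsAncestral) {x y z : V}
    (hxy : G.arrow x y) (hyz : G.skel.Adj y z) (h : ¬ G.arrow z y) : G.Dir y z := by
  refine ⟨?_, h⟩
  by_contra hn
  exact hG.2 z y x ⟨hyz.symm, h, hn⟩ hxy

/-- An active walk can be shortened to an active path. -/
theorem IsAncestral.exists_injOn_activeSeq (hG : G.IsAncestral) {n : ℕ} {f : ℕ → V}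
    (hf : G.ActiveSeq S n f) : ∃ (m : ℕ) (g : ℕ → V), g 0 = f 0 ∧ g m = f n ∧
      Set.InjOn g {i | i ≤ m} ∧ G.ActiveSeq S m g := by
  induction n using Nat.strong_induction_on generalizing f with
  | _ n ih =>
  by_cases hinj : Set.InjOn f {i | i ≤ n}
  · exact ⟨n, f, rfl, rfl, hinj, hf⟩
  obtain ⟨i, d, hd, hid, heq⟩ : ∃ i d, 0 < d ∧ i + d ≤ n ∧ f (i + d) = f i := by
    simp only [Set.InjOn, Set.mem_ofPred_eq, not_forall] at hinj
    obtain ⟨a, ha, b, hb, hab, hne⟩ := hinj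
    rcases lt_or_gt_of_ne hne with h | h
    · exact ⟨a, b - a, by omega, by omega, by rw [show a + (b - a) = b by omega, hab]⟩
    · exact ⟨b, a - b, by omega, by omega, by rw [show b + (a - b) = a by omega, hab]⟩
  obtain ⟨hadj, hact⟩ := hf
  -- The loop between two visits to the same node is cut out. By `heq` both branches agree at `k =
  -- i`; only there can the collider status of a node change.
  set g : ℕ → V := fun k => if k ≤ i then f k else f (k + d) with hg
  have g1 : ∀ k, k ≤ i → g k = f k := fun k hk => by simp [hg, hk]
  have g2 : ∀ k, i ≤ k → g k = f (k + d) := fun k hk => by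
    rcases hk.eq_or_lt with rfl | hk
    · rw [g1 _ le_rfl, heq]
    · simp [hg, not_le.2 hk]
  obtain ⟨m, g', h0, hm, hinj', hact'⟩ := ih (n - d) (by omega) (f := g) (by
    refine ⟨fun k hk => ?_, fun k hk => ?_⟩
    · by_cases hki : k < i
      · rw [g1 k (by omega), g1 (k + 1) (by omega)]
        exact hadj k (by omega)
      · rw [g2 k (by omega), g2 (k + 1) (by omega), show k + 1 + d = k + d + 1 by omega]
        exact hadj _ (by omega)
    · rcases lt_trichotomy (k + 1) i with hki | rfl | hki
      · rw [g1 k (by omega), g1 (k + 1) (by omega), g1 (k + 2) (by omega)]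
        exact hact k (by omega)
      · rw [g1 k (by omega), g1 (k + 1) (by omega), g2 (k + 2) (by omega)]
        have t1 := hact k (by omega)
        have t2 := hact (k + d) (by omega)
        rw [show k + d + 1 = k + 1 + d by omega, heq, show k + d + 2 = k + 2 + d by omega] at t2
        refine ⟨fun hcol => ?_, fun hcol => ?_⟩
        -- A new collider at the junction: the loop leaves this node along a directed edge. It stays
        -- directed until it meets a collider, which has a descendant in `S`, or else it closes to a
        -- directed cycle.
        · by_cases hc1 : G.ColliderAt (f k) (f (k + 1)) (f (k + 2))
          · exact t1.1 hc1
          by_contra hS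
          have hd0 : G.Dir (f (k + 1)) (f (k + 2)) :=
            hG.dir_of_arrow_of_not_arrow hcol.1 (hadj _ (by omega)) fun h => hc1 ⟨hcol.1, h⟩
          have key : ∀ e, e < d → G.Dir (f (k + 1 + e)) (f (k + 1 + e + 1)) ∧
              G.Anc (f (k + 1)) (f (k + 1 + e)) := by
            intro e
            induction e with
            | zero => exact fun _ => ⟨hd0, .refl⟩
            | succ e ihe =>
              intro he
              obtain ⟨hd', ha'⟩ := ihe (by omega)
              have ha'' := ha'.tail hd'
              refine ⟨hG.dir_of_arrow_of_not_arrow hd'.1 (hadj _ (by omega)) fun har => hS ?_, ha''⟩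
              obtain ⟨s, hs, hsa⟩ := (hact (k + 1 + e) (by omega)).1 ⟨hd'.1, har⟩
              exact ⟨s, hs, ha''.trans hsa⟩
          obtain ⟨hd', ha'⟩ := key (d - 1) (by omega)
          rw [show k + 1 + (d - 1) + 1 = k + 1 + d by omega, heq] at hd'
          exact hG.1 _ _ hd'.1 ha'
        -- A non-collider at the junction was already a non-collider at one of the two visits.
        · by_cases har : G.arrow (f k) (f (k + 1))
          · exact t2.2 fun h => hcol ⟨har, h.2⟩
          · exact t1.2 fun h => har h.1
      · rw [g2 k (by omega), g2 (k + 1) (by omega), g2 (k + 2) (by omega),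
          show k + 1 + d = k + d + 1 by omega, show k + 2 + d = k + d + 2 by omega]
        exact hact (k + d) (by omega))
  refine ⟨m, g', by rw [h0, g1 0 (by omega)], ?_, hinj', hact'⟩
  rw [hm, g2 _ (by omega), show n - d + d = n by omega]

/-! ### Extending active walks; inducing paths. -/

/-- `ActiveTo S x a b`: there is an active walk that starts in `x` and ends with the edge
`a, b`. -/
inductive ActiveTo (G : MixedGraph V) (S : Finset V) (x : V) : V → V → Prop
  | edge (b : V) : G.skel.Adj x b → ActiveTo G S x x b
  | snoc (a b c : V) : ActiveTo G S x a b → G.skel.Adj b c →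
      (G.ColliderAt a b c → ∃ s ∈ S, G.Anc b s) → (¬ G.ColliderAt a b c → b ∉ S) →
      ActiveTo G S x b c

theorem ActiveTo.exists_activeSeq {x a b : V} (h : G.ActiveTo S x a b) :
    ∃ (n : ℕ) (f : ℕ → V), f 0 = x ∧ f n = a ∧ f (n + 1) = b ∧ G.ActiveSeq S (n + 1) f := by
  induction h with
  | edge b hb =>
    refine ⟨0, fun i => if i = 0 then x else b, by simp, by simp, by simp, fun i hi => ?_,
      fun i hi => by omega⟩
    obtain rfl : i = 0 := by omega
    simpa using hb
  | snoc a b c _ hbc hcol hncol ih =>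
    obtain ⟨n, f, h0, hn, hn1, hadj, hact⟩ := ih
    have e : ∀ i, i ≤ n + 1 → (fun i => if i ≤ n + 1 then f i else c) i = f i :=
      fun i hi => by simp [hi]
    refine ⟨n + 1, fun i => if i ≤ n + 1 then f i else c, by simp [h0], by simp [hn1], by simp,
      fun i hi => ?_, fun i hi => ?_⟩
    · by_cases hin : i = n + 1
      · subst hin
        simpa [hn1] using hbc
      · rw [e i (by omega), e (i + 1) (by omega)]
        exact hadj i (by omega)
    · by_cases hin : i = n
      · subst hin
        simpa [hn, hn1] using And.intro hcol hncol
      · rw [e i (by omega), e (i + 1) (by omega), e (i + 2) (by omega)]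
        exact hact i (by omega)

theorem IsAncestral.not_sep_of_activeTo (hG : G.IsAncestral) {x a y : V}
    (h : G.ActiveTo S x a y) : ¬ G.Sep x y S := by
  obtain ⟨n, f, h0, -, hn, hf⟩ := h.exists_activeSeq
  obtain ⟨m, g, h0', hm, hinj, hg⟩ := hG.exists_injOn_activeSeq hf
  exact not_sep_iff.2 ⟨m, g, h0'.trans h0, hm.trans hn, hinj, hg⟩

/-- The directed path is run backwards from `x`; its inner nodes are non-colliders outside `S`. The
walk reaches `v` at a tail, so `v` is a non-collider however the walk goes on. -/
theorem ActiveTo.of_transGen_dir {x v : V} (h : Relation.TransGen G.Dir v x)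
    (hv : ∀ w, G.Anc v w → w ∉ S) : ∃ a, G.ActiveTo S x a v ∧ G.Dir v a := by
  induction h using Relation.TransGen.head_induction_on with
  | single h => exact ⟨x, .edge _ (G.arrow_adj _ _ h.1).symm, h⟩
  | head h _ ih =>
    obtain ⟨a, ha, hd⟩ := ih fun w hw => hv w (.head h hw)
    exact ⟨_, .snoc _ _ _ ha (G.arrow_adj _ _ h.1).symm (fun hc => absurd hc.1 hd.2)
      fun _ => hv _ (.single h), h⟩

theorem ActiveTo.trans_anc {x a b y : V} (h : G.ActiveTo S x a b) (hby : G.Anc b y)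
    (hb : ∀ w, G.Anc b w → w ∉ S) : ∃ c, G.ActiveTo S x c y := by
  induction hby using Relation.ReflTransGen.head_induction_on generalizing a with
  | refl => exact ⟨a, h⟩
  | head hd _ ih =>
    exact ih (.snoc _ _ _ h (G.arrow_adj _ _ hd.1) (fun hc => absurd hc.2 hd.2)
      fun _ => hb _ .refl) fun w hw => hb w (.head hd hw)

/-- The ends of an inducing path are connected given every set. -/
theorem IsAncestral.not_sep_of_inducing (hG : G.IsAncestral) {n : ℕ} {f : ℕ → V} (hn : 0 < n)
    (hadj : ∀ i, i < n → G.skel.Adj (f i) (f (i + 1)))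
    (hcol : ∀ i, i + 2 ≤ n → G.ColliderAt (f i) (f (i + 1)) (f (i + 2)))
    (hanc : ∀ i, i + 2 ≤ n → G.Anc (f (i + 1)) (f 0) ∨ G.Anc (f (i + 1)) (f n))
    (hne : ∀ i, i + 2 ≤ n → f (i + 1) ≠ f 0) : ¬ G.Sep (f 0) (f n) S := by
  -- An active walk from `f 0` is pushed along the path, entering each collider by an arrowhead. A
  -- collider with a descendant in `S` is passed. Any other is an ancestor of `f n`, and a directed
  -- path finishes the walk, or of `f 0`, and the walk is replaced by one that arrives at a tail.
  have key : ∀ k, k + 1 ≤ n → (∃ a, G.ActiveTo S (f 0) a (f n)) ∨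
      ∃ a, G.ActiveTo S (f 0) a (f (k + 1)) ∧ (k + 2 ≤ n → G.arrow a (f (k + 1))) := by
    intro k
    induction k with
    | zero => exact fun _ => .inr ⟨_, .edge _ (hadj 0 (by omega)), fun h => (hcol 0 h).1⟩
    | succ k ih =>
      intro hk
      rcases ih (by omega) with h | ⟨a, ha, har⟩
      · exact .inl h
      have har := har hk
      have hc := hcol k hk
      have har' : k + 1 + 2 ≤ n → G.arrow (f (k + 1)) (f (k + 1 + 1)) := fun h =>
        (hcol (k + 1) h).1
      by_cases hS : ∃ s ∈ S, G.Anc (f (k + 1)) s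
      · exact .inr ⟨_, .snoc _ _ _ ha (hadj _ (by omega)) (fun _ => hS)
          fun h => absurd ⟨har, hc.2⟩ h, har'⟩
      · have hS' : ∀ w, G.Anc (f (k + 1)) w → w ∉ S := fun w hw hwS => hS ⟨w, hwS, hw⟩
        rcases hanc k hk with h | h
        · rcases Relation.reflTransGen_iff_eq_or_transGen.1 h with h | h
          · exact absurd h.symm (hne k hk)
          · obtain ⟨a', ha', hd⟩ := ActiveTo.of_transGen_dir h hS'
            exact .inr ⟨_, .snoc _ _ _ ha' (hadj _ (by omega)) (fun hc => absurd hc.1 hd.2)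
              fun _ => hS' _ .refl, har'⟩
        · exact .inl (ha.trans_anc h hS')
  obtain ⟨a, ha⟩ : ∃ a, G.ActiveTo S (f 0) a (f n) := by
    rcases key (n - 1) (by omega) with h | ⟨a, ha, -⟩
    · exact h
    · rw [show n - 1 + 1 = n by omega] at ha
      exact ⟨a, ha⟩
  exact hG.not_sep_of_activeTo ha

/-! ### Anterior nodes and separating sets in maximal ancestral graphs. -/

/-- `x` has a path to `y` along edges each of which has a tail at its first node. -/
def Ant (G : MixedGraph V) : V → V → Prop :=
  Relation.ReflTransGen fun x y => G.skel.Adj x y ∧ ¬ G.arrow y x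

theorem Anc.ant {x y : V} (h : G.Anc x y) : G.Ant x y :=
  Relation.ReflTransGen.mono (fun _ _ h => ⟨G.arrow_adj _ _ h.1, h.2⟩) _ _ h

/-- A node with an arrowhead has no undirected edge, so the first edge is directed and hands an
arrowhead on to the next node. -/
theorem IsAncestral.anc_of_ant (hG : G.IsAncestral) {u x y : V} (hu : G.arrow u x)
    (h : G.Ant x y) : G.Anc x y := by
  induction h using Relation.ReflTransGen.head_induction_on generalizing u with
  | refl => exact .refl
  | head h _ ih =>
    have hd := hG.dir_of_arrow_of_not_arrow hu h.1 h.2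
    exact .head hd (ih hd.1)

/-- A non-collider on an active walk is anterior to a later collider or to the end. -/
theorem IsAncestral.ant_of_activeSeq (hG : G.IsAncestral) {n : ℕ} {f : ℕ → V}
    (hf : G.ActiveSeq S n f) {A : Set V} (hA : ∀ v w, G.Ant v w → w ∈ A → v ∈ A)
    (hS : ∀ s ∈ S, s ∈ A) (hn : f n ∈ A) (k i : ℕ) (hki : i + 1 + k = n)
    (hi : ¬ G.arrow (f (i + 1)) (f i)) : f i ∈ A := by
  induction k generalizing i with
  | zero =>
    obtain rfl : n = i + 1 := by omega
    exact hA _ _ (.single ⟨hf.1 i (by omega), hi⟩) hn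
  | succ k ih =>
    refine hA _ _ (.single ⟨hf.1 i (by omega), hi⟩) ?_
    by_cases hcol : G.ColliderAt (f i) (f (i + 1)) (f (i + 2))
    · obtain ⟨s, hs, ha⟩ := (hf.2 i (by omega)).1 hcol
      exact hA _ _ ha.ant (hS s hs)
    · refine ih (i + 1) (by omega) fun h => ?_
      by_cases har : G.arrow (f i) (f (i + 1))
      · exact hcol ⟨har, h⟩
      · exact hG.2 _ _ _ ⟨hf.1 i (by omega), har, hi⟩ h

/-- Two non-adjacent nodes `x`, `y` of a maximal ancestral graph are separated by a set of nodes
to which `x` has collider paths. -/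
theorem IsMAG.exists_sep_of_not_adj [Finite V] (hG : G.IsMAG) {x y : V} (hxy : x ≠ y)
    (hadj : ¬ G.skel.Adj x y) : ∃ S : Finset V, G.Sep x y S ∧ ∀ s ∈ S, s ≠ x ∧ s ≠ y ∧
      ∃ (n : ℕ) (f : ℕ → V), f 0 = x ∧ f n = s ∧ Set.InjOn f {i | i ≤ n} ∧
        (∀ i, i < n → G.skel.Adj (f i) (f (i + 1))) ∧
        ∀ i, i + 2 ≤ n → G.ColliderAt (f i) (f (i + 1)) (f (i + 2)) := by
  classical
  set A : Set V := {v | G.Ant v x ∨ G.Ant v y} with hAdef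
  have hA : ∀ v w, G.Ant v w → w ∈ A → v ∈ A := fun v w hvw hw => hw.imp hvw.trans hvw.trans
  -- All nodes anterior to `x` or `y` that `x` reaches by a collider path.
  set T : Set V := {s | s ∈ A ∧ s ≠ x ∧ s ≠ y ∧
      ∃ (n : ℕ) (f : ℕ → V), f 0 = x ∧ f n = s ∧ Set.InjOn f {i | i ≤ n} ∧
        (∀ i, i < n → G.skel.Adj (f i) (f (i + 1))) ∧
        ∀ i, i + 2 ≤ n → G.ColliderAt (f i) (f (i + 1)) (f (i + 2))} with hT
  refine ⟨T.toFinite.toFinset, ?_, fun s hs => ((Set.Finite.mem_toFinset _).1 hs).2⟩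
  by_contra hc
  obtain ⟨n, f, h0, hn, hinj, hf⟩ := not_sep_iff.1 hc
  have hS : ∀ s ∈ T.toFinite.toFinset, s ∈ A := fun s hs => ((Set.Finite.mem_toFinset _).1 hs).1
  have hn0 : 0 < n := by
    rcases Nat.eq_zero_or_pos n with rfl | h
    · exact absurd (h0.symm.trans hn) hxy
    · exact h
  have hmem : ∀ i, i + 2 ≤ n → f (i + 1) ∈ A := by
    intro i hi
    by_cases hcol : G.ColliderAt (f i) (f (i + 1)) (f (i + 2))
    · obtain ⟨s, hs, ha⟩ := (hf.2 i hi).1 hcol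
      exact hA _ _ ha.ant (hS s hs)
    -- A non-collider has a tail on one side; in that direction it is anterior to a collider or to
    -- an end of the path.
    · by_cases har : G.arrow (f (i + 2)) (f (i + 1))
      · have := hG.1.ant_of_activeSeq hf.reverse hA hS (by simp only [Nat.sub_self, h0]; exact .inl .refl) i
          (n - (i + 1)) (by omega) (by
            rw [show n - (n - (i + 1) + 1) = i by omega, show n - (n - (i + 1)) = i + 1 by omega]
            exact fun h => hcol ⟨h, har⟩)
        rwa [show n - (n - (i + 1)) = i + 1 by omega] at this
      · exact hG.1.ant_of_activeSeq hf hA hS (by rw [hn]; exact .inr .refl) (n - (i + 2)) (i + 1)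
          (by omega) har
  have hcol : ∀ i, i + 2 ≤ n → G.ColliderAt (f i) (f (i + 1)) (f (i + 2)) := by
    intro i
    induction i using Nat.strong_induction_on with
    | _ i ih =>
    intro hi
    by_contra hnc
    -- The first non-collider would end a collider path from `x`, hence lie in the conditioning set
    -- and block.
    refine (hf.2 i hi).2 hnc ((Set.Finite.mem_toFinset _).2 ⟨hmem i hi, ?_, ?_, i + 1, f, h0, rfl,
      hinj.mono fun j (hj : j ≤ i + 1) => (by simp; omega), fun j hj => hf.1 j (by omega),
      fun j hj => ih j (by omega) (by omega)⟩)
    · intro h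
      have := hinj (show i + 1 ≤ n by omega) (show 0 ≤ n by omega) (h.trans h0.symm)
      omega
    · intro h
      have := hinj (show i + 1 ≤ n by omega) (show n ≤ n by omega) (h.trans hn.symm)
      omega
  -- All inner nodes are colliders and ancestors of `x` or `y`: this is an inducing path, which
  -- maximality forbids.
  obtain ⟨Z, -, -, hZ⟩ := hG.2 x y hxy hadj
  subst h0 hn
  refine hG.1.not_sep_of_inducing hn0 hf.1 hcol (fun i hi => ?_) (fun i hi h => ?_) hZ
  · exact (hmem i hi).imp (hG.1.anc_of_ant (hcol i hi).1) (hG.1.anc_of_ant (hcol i hi).1)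
  · have := hinj (show i + 1 ≤ n by omega) (show 0 ≤ n by omega) h
    omega

end MixedGraph

/-! ### Graphs that represent the test results -/

namespace MixedGraph

variable {V : Type u} {G : MixedGraph V} {L : TestLog V} {S : Finset V}

theorem Represents.sep_of_ind (hL : G.Represents L) {x y : V} (h : L.Ind x y S) :
    G.Sep x y S :=
  h.elim (fun h => (hL.1 h).2) fun h => (hL.1 h).2.symm

theorem Represents.not_sep_of_dep (hL : G.Represents L) {x y : V} (h : L.Dep x y S) :
    ¬ G.Sep x y S :=
  h.elim (fun h => (hL.2 h).2) fun h hs => (hL.2 h).2 hs.symm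

theorem Represents.ind_of_tested (hL : G.Represents L) {x y : V} (h : L.Tested x y S)
    (hs : G.Sep x y S) : L.Ind x y S := by
  have aux : ∀ a b, (a, b, S) ∈ L.tested → G.Sep a b S → (a, b, S) ∈ L.ind := fun a b ht hs => by
    refine ⟨ht, ?_⟩
    by_contra hi
    exact (hL.2 ⟨ht, by simpa using hi⟩).2 hs
  exact h.imp (fun h => aux _ _ h hs) fun h => aux _ _ h hs.symm

theorem Represents.not_adj_of_ind (hL : G.Represents L) {x y : V} (h : L.Ind x y S) :
    ¬ G.skel.Adj x y :=
  not_adj_of_sep (hL.sep_of_ind h)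

end MixedGraph

/-! ### Classification of unshielded triples -/

namespace TripleRule

variable {V : Type u} {rule : TripleRule} {𝒮 : Set (Finset V)} {y : V}

/-- One witness is all that soundness needs from a verdict, since in a representing graph all
consulted sets agree on `y`. -/
theorem SaysCollider.exists_notMem (h : rule.SaysCollider 𝒮 y) : ∃ S ∈ 𝒮, y ∉ S := by
  have aux : (𝒮.Nonempty ∧ ∀ S ∈ 𝒮, y ∉ S) → ∃ S ∈ 𝒮, y ∉ S := fun ⟨⟨S, hS⟩, h⟩ =>
    ⟨S, hS, h S hS⟩
  cases rule with
  | standard => exact aux h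
  | conservative => exact aux h
  | majority =>
    by_contra! hc
    have : {S | S ∈ 𝒮 ∧ y ∈ S} = 𝒮 := Set.ext fun S => ⟨And.left, fun hS => ⟨hS, hc S hS⟩⟩
    simp only [SaysCollider, this] at h
    omega

theorem SaysNoncollider.exists_mem (h : rule.SaysNoncollider 𝒮 y) : ∃ S ∈ 𝒮, y ∈ S := by
  have aux : (𝒮.Nonempty ∧ ∀ S ∈ 𝒮, y ∈ S) → ∃ S ∈ 𝒮, y ∈ S := fun ⟨⟨S, hS⟩, h⟩ =>
    ⟨S, hS, h S hS⟩
  cases rule with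
  | standard => exact aux h
  | conservative => exact aux h
  | majority =>
    by_contra! hc
    have : {S | S ∈ 𝒮 ∧ y ∈ S} = ∅ := Set.eq_empty_of_forall_notMem fun S hS => hc S hS.1 hS.2
    simp [SaysNoncollider, this] at h

/-- Finiteness matters for the majority rule: `ncard` is `0` on infinite sets, and the strict
inequality would fail. -/
theorem saysCollider_of_forall (hne : 𝒮.Nonempty) (hfin : 𝒮.Finite) (h : ∀ S ∈ 𝒮, y ∉ S) :
    rule.SaysCollider 𝒮 y := by
  cases rule with
  | standard => exact ⟨hne, h⟩
  | conservative => exact ⟨hne, h⟩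
  | majority =>
    have : {S | S ∈ 𝒮 ∧ y ∈ S} = ∅ := Set.eq_empty_of_forall_notMem fun S hS => h S hS.1 hS.2
    simpa [SaysCollider, this] using (Set.ncard_pos hfin).2 hne

theorem saysNoncollider_of_forall (hne : 𝒮.Nonempty) (hfin : 𝒮.Finite) (h : ∀ S ∈ 𝒮, y ∈ S) :
    rule.SaysNoncollider 𝒮 y := by
  cases rule with
  | standard => exact ⟨hne, h⟩
  | conservative => exact ⟨hne, h⟩
  | majority =>
    have : {S | S ∈ 𝒮 ∧ y ∈ S} = 𝒮 := Set.ext fun S => ⟨And.left, fun hS => ⟨hS, h S hS⟩⟩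
    have hpos := (Set.ncard_pos hfin).2 hne
    simp only [SaysNoncollider, this]
    omega

variable {useSep : Bool} {L : TestLog V} {sep : V → V → Finset V}
  {cand : V → V → Set (Finset V)} {x z : V}

theorem ind_of_mem_consulted (hsep : L.Ind x z (sep x z)) {S : Finset V}
    (hS : S ∈ rule.consulted useSep L sep cand x z) : L.Ind x z S := by
  cases rule with
  | standard => obtain rfl : S = sep x z := hS
                exact hsep
  | conservative => exact hS.1
  | majority => exact hS.1

theorem consulted_nonempty (h : rule ≠ .standard → ∃ S, L.Ind x z S ∧
    (S ∈ cand x z ∨ (useSep = true ∧ S = sep x z))) :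
    (rule.consulted useSep L sep cand x z).Nonempty := by
  cases rule with
  | standard => exact ⟨_, rfl⟩
  | conservative => exact h (by simp)
  | majority => exact h (by simp)

theorem consulted_finite (h : (cand x z).Finite) :
    (rule.consulted useSep L sep cand x z).Finite := by
  have aux : {S | L.Ind x z S ∧ (S ∈ cand x z ∨ (useSep = true ∧ S = sep x z))}.Finite := by
    refine (h.union (Set.finite_singleton (sep x z))).subset fun S hS => ?_
    exact hS.2.imp id And.right
  cases rule with
  | standard => exact Set.finite_singleton _
  | conservative => exact aux
  | majority => exact aux

variable {G : MixedGraph V}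

theorem SaysCollider.colliderAt (hL : G.Represents L) (hxy : G.skel.Adj x y)
    (hyz : G.skel.Adj y z) (hxz : x ≠ z) (hsep : L.Ind x z (sep x z))
    (h : rule.SaysCollider (rule.consulted useSep L sep cand x z) y) : G.ColliderAt x y z := by
  obtain ⟨S, hS, hy⟩ := h.exists_notMem
  by_contra hc
  exact hy ((MixedGraph.mem_iff_not_colliderAt_of_sep hxy hyz hxz
    (hL.sep_of_ind (ind_of_mem_consulted hsep hS))).2 hc)

theorem SaysNoncollider.not_colliderAt (hL : G.Represents L) (hxy : G.skel.Adj x y)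
    (hyz : G.skel.Adj y z) (hxz : x ≠ z) (hsep : L.Ind x z (sep x z))
    (h : rule.SaysNoncollider (rule.consulted useSep L sep cand x z) y) :
    ¬ G.ColliderAt x y z := by
  obtain ⟨S, hS, hy⟩ := h.exists_mem
  exact (MixedGraph.mem_iff_not_colliderAt_of_sep hxy hyz hxz
    (hL.sep_of_ind (ind_of_mem_consulted hsep hS))).1 hy

/-- Every consulted set separates `x` and `z` in `G`, so the verdict is unanimous. The standard rule
always has its recorded set; for the others `hne` ensures that some set is consulted. -/
theorem says_of_represents (hL : G.Represents L) (hxy : G.skel.Adj x y) (hyz : G.skel.Adj y z)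
    (hxz : x ≠ z) (hsep : L.Ind x z (sep x z)) (hfin : (cand x z).Finite)
    (hne : rule ≠ .standard → ∃ S, L.Ind x z S ∧
      (S ∈ cand x z ∨ (useSep = true ∧ S = sep x z))) :
    rule.SaysCollider (rule.consulted useSep L sep cand x z) y ∨
      rule.SaysNoncollider (rule.consulted useSep L sep cand x z) y := by
  have hmem : ∀ S ∈ rule.consulted useSep L sep cand x z, y ∈ S ↔ ¬ G.ColliderAt x y z :=
    fun S hS => MixedGraph.mem_iff_not_colliderAt_of_sep hxy hyz hxz
      (hL.sep_of_ind (ind_of_mem_consulted hsep hS))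
  by_cases hc : G.ColliderAt x y z
  · exact .inl (saysCollider_of_forall (consulted_nonempty hne) (consulted_finite hfin)
      fun S hS hy => (hmem S hS).1 hy hc)
  · exact .inr (saysNoncollider_of_forall (consulted_nonempty hne) (consulted_finite hfin)
      fun S hS => (hmem S hS).2 hc)

end TripleRule

/-! ### Soundness of the orientation rules -/

theorem MeekDerived.dir {V : Type u} {G : MixedGraph V} (hG : G.IsDAG) {pre : V → V → Prop}
    {col noncol : V → V → V → Prop} (hpre : ∀ x y, pre x y → G.Dir x y)
    (hcol : ∀ x y z, col x y z → G.ColliderAt x y z)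
    (hnon : ∀ x y z, noncol x y z → G.skel.Adj x y ∧ G.skel.Adj y z ∧ ¬ G.ColliderAt x y z)
    {x y : V} (h : MeekDerived G.skel pre col noncol x y) : G.Dir x y := by
  induction h with
  | pre x y h => exact hpre x y h
  | colLeft x y z h => exact hG.dir_of_arrow (hcol x y z h).1
  | colRight x y z h => exact hG.dir_of_arrow (hcol x y z h).2
  | r1 x y z _ h ih =>
    obtain ⟨-, hyz, hc⟩ := hnon x y z h
    exact hG.dir_of_not_arrow hyz fun har => hc ⟨ih.1, har⟩
  | r2 x y z _ _ hxz ih₁ ih₂ =>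
    refine hG.dir_of_not_arrow hxz fun har => ?_
    exact hG.not_anc (hG.dir_of_arrow har) (.head ih₁ (.single ih₂))
  | r3 x y w z h hxz _ _ ih₁ ih₂ =>
    obtain ⟨hyx, hxw, hc⟩ := hnon y x w h
    -- If `z → x`, acyclicity forces `y → x` and `w → x`, which makes `x` a collider between `y` and
    -- `w`.
    refine hG.dir_of_not_arrow hxz fun har => hc ?_
    have hzx := hG.dir_of_arrow har
    constructor
    · refine (hG.dir_of_not_arrow hyx fun har' => ?_).1
      exact hG.not_anc hzx (.head (hG.dir_of_arrow har') (.single ih₁))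
    · refine (hG.dir_of_not_arrow hxw.symm fun har' => ?_).1
      exact hG.not_anc hzx (.head (hG.dir_of_arrow har') (.single ih₂))

theorem MeekPhase.not_hasConflict {V : Type u} {G : MixedGraph V} (hG : G.IsDAG)
    {pre : V → V → Prop} {col noncol : V → V → V → Prop} {out : OutGraph V}
    (hskel : out.skel = G.skel) (h : MeekPhase pre col noncol out)
    (hpre : ∀ x y, pre x y → G.Dir x y) (hcol : ∀ x y z, col x y z → G.ColliderAt x y z)
    (hnon : ∀ x y z, noncol x y z → G.skel.Adj x y ∧ G.skel.Adj y z ∧ ¬ G.ColliderAt x y z) :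
    ¬ out.HasConflict := by
  rintro ⟨x, y, -, hh, ht⟩
  obtain ⟨D, -, -, hD, hhead, htail⟩ := h
  rw [hskel] at hD
  exact ((hD _ _ ((hhead x y).1 hh)).dir hG hpre hcol hnon).2
    ((hD _ _ ((htail x y).1 ht)).dir hG hpre hcol hnon).1

/-! ### Walks without colliders and discriminating paths. -/

namespace MixedGraph

variable {V : Type u} {G : MixedGraph V}

/-- A walk without colliders that starts with a directed edge is directed. -/
theorem IsAncestral.anc_of_noncolliders (hG : G.IsAncestral) {n : ℕ} {f : ℕ → V}
    (hadj : ∀ i, i < n → G.skel.Adj (f i) (f (i + 1)))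
    (hnc : ∀ i, i + 2 ≤ n → ¬ G.ColliderAt (f i) (f (i + 1)) (f (i + 2)))
    (h0 : G.Dir (f 0) (f 1)) : ∀ i, i + 1 ≤ n → G.Dir (f i) (f (i + 1)) ∧ G.Anc (f 0) (f (i + 1))
  | 0, _ => ⟨h0, .single h0⟩
  | i + 1, hi => by
    obtain ⟨hd, ha⟩ := hG.anc_of_noncolliders hadj hnc h0 i (by omega)
    have hd' := hG.dir_of_arrow_of_not_arrow hd.1 (hadj (i + 1) (by omega))
      fun har => hnc i (by omega) ⟨hd.1, har⟩
    exact ⟨hd', ha.tail hd'⟩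

theorem IsAncestral.anc_of_walk (hG : G.IsAncestral) {a b : V} (p : G.skel.Walk a b)
    (hp : 0 < p.length)
    (hnc : ∀ i, i + 2 ≤ p.length →
      ¬ G.ColliderAt (p.getVert i) (p.getVert (i + 1)) (p.getVert (i + 2)))
    (h0 : G.Dir a (p.getVert 1)) : G.Anc a b := by
  have := (hG.anc_of_noncolliders (f := p.getVert) (fun i hi => p.adj_getVert_succ hi) hnc
    (by rwa [p.getVert_zero]) (p.length - 1) (by omega)).2
  rwa [show p.length - 1 + 1 = p.length by omega, p.getVert_length, p.getVert_zero] at this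

/-- A discriminating path `f 0, …, f (k + 1), c` for `f (k + 1)`: the nodes `f 1, …, f k` are
colliders and parents of `c`. A set that separates its ends contains `f (k + 1)` exactly if that
node is a non-collider. -/
theorem mem_iff_of_discriminating {S : Finset V} {k : ℕ} {f : ℕ → V} {c : V}
    (hinj : Set.InjOn f {i | i ≤ k + 1}) (hc : ∀ i, i ≤ k + 1 → f i ≠ c)
    (hadj : ∀ i, i < k + 1 → G.skel.Adj (f i) (f (i + 1))) (hbc : G.skel.Adj (f (k + 1)) c)
    (hcol : ∀ i, i + 1 ≤ k → G.ColliderAt (f i) (f (i + 1)) (f (i + 2)))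
    (hpar : ∀ i, i + 1 ≤ k → G.Dir (f (i + 1)) c) (hsep : G.Sep (f 0) c S) :
    f (k + 1) ∈ S ↔ ¬ G.ColliderAt (f k) (f (k + 1)) c := by
  -- Going along the path, each `f (j + 1)` with `j < k` is a parent of `c`, hence a non-collider
  -- before `c`, hence in `S`. So the earlier colliders are open, and only `f (j + 1)` can block the
  -- path that turns off to `c` there.
  have key : ∀ j, j ≤ k → (f (j + 1) ∈ S ↔ ¬ G.ColliderAt (f j) (f (j + 1)) c) := by
    intro j
    induction j using Nat.strong_induction_on with
    | _ j ih =>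
    intro hj
    have hmem : ∀ i, i < j → f (i + 1) ∈ S := fun i hi =>
      (ih i hi (by omega)).2 fun h => (hpar i (by omega)).2 h.2
    by_contra hne
    set g : ℕ → V := fun i => if i ≤ j + 1 then f i else c with hg
    have g1 : ∀ i, i ≤ j + 1 → g i = f i := fun i hi => by simp [hg, hi]
    have g2 : g (j + 2) = c := by simp [hg]
    refine not_sep_iff.2 ⟨j + 2, g, g1 0 (by omega), g2, ?_, fun i hi => ?_, fun i hi => ?_⟩ hsep
    · intro a ha b hb hab
      simp only [Set.mem_ofPred_eq] at ha hb
      rcases Nat.lt_or_ge a (j + 2) with ha' | ha' <;> rcases Nat.lt_or_ge b (j + 2) with hb' | hb'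
      · rw [g1 a (by omega), g1 b (by omega)] at hab
        exact hinj (show a ≤ k + 1 by omega) (show b ≤ k + 1 by omega) hab
      · obtain rfl : b = j + 2 := by omega
        rw [g1 a (by omega), g2] at hab
        exact absurd hab (hc a (by omega))
      · obtain rfl : a = j + 2 := by omega
        rw [g1 b (by omega), g2] at hab
        exact absurd hab.symm (hc b (by omega))
      · omega
    · rcases Nat.lt_or_ge i (j + 1) with hi' | hi'
      · rw [g1 i (by omega), g1 (i + 1) (by omega)]
        exact hadj i (by omega)
      · obtain rfl : i = j + 1 := by omega
        rw [g1 (j + 1) le_rfl, g2]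
        rcases hj.eq_or_lt with rfl | hj
        · exact hbc
        · exact G.arrow_adj _ _ (hpar j hj).1
    · rcases Nat.lt_or_ge i j with hi' | hi'
      · rw [g1 i (by omega), g1 (i + 1) (by omega), g1 (i + 2) (by omega)]
        exact ⟨fun _ => ⟨_, hmem i hi', .refl⟩, fun h => absurd (hcol i (by omega)) h⟩
      · obtain rfl : i = j := by omega
        rw [g1 i (by omega), g1 (i + 1) (by omega), g2]
        by_cases hcc : G.ColliderAt (f i) (f (i + 1)) c
        · have hy : f (i + 1) ∈ S := by tauto
          exact ⟨fun _ => ⟨_, hy, .refl⟩, fun hn => absurd hcc hn⟩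
        · exact ⟨fun hn => absurd hn hcc, fun _ => by tauto⟩
  exact key k le_rfl

end MixedGraph

/-! ### Cycles without colliders. -/

namespace MixedGraph

variable {V : Type u} {G : MixedGraph V}

/-- An arrowhead on the cycle makes the next edge directed, and so on all the way round to the node
where the arrowhead started, against ancestrality. The cycle of `m + 2` nodes is unrolled twice in
`g`, so that one full turn can start anywhere. -/
theorem IsAncestral.not_arrow_of_cycle_aux (hG : G.IsAncestral) {m : ℕ} {f : ℕ → V}
    (hadj : ∀ i, i < m + 1 → G.skel.Adj (f i) (f (i + 1))) (hclose : G.skel.Adj (f (m + 1)) (f 0))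
    (hnc : ∀ i, i + 1 ≤ m → ¬ G.ColliderAt (f i) (f (i + 1)) (f (i + 2)))
    (hfst : ¬ G.ColliderAt (f (m + 1)) (f 0) (f 1))
    (hlst : ¬ G.ColliderAt (f m) (f (m + 1)) (f 0)) :
    (∀ i, i < m + 1 → ¬ G.arrow (f i) (f (i + 1))) ∧ ¬ G.arrow (f (m + 1)) (f 0) := by
  set g : ℕ → V := fun i => if i ≤ m + 1 then f i else f (i - (m + 2)) with hg
  have g1 : ∀ i, i ≤ m + 1 → g i = f i := fun i hi => by simp [hg, hi]
  have g2 : ∀ i j, i = j + (m + 2) → g i = f j := by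
    rintro i j rfl
    have : ¬ j + (m + 2) ≤ m + 1 := by omega
    simp [hg, this]
  have gadj : ∀ i, i < m + 1 + (m + 2) → G.skel.Adj (g i) (g (i + 1)) := by
    intro i hi
    rcases lt_trichotomy i (m + 1) with h | rfl | h
    · rw [g1 i (by omega), g1 (i + 1) (by omega)]
      exact hadj i h
    · rw [g1 (m + 1) le_rfl, g2 _ 0 (by omega)]
      exact hclose
    · rw [g2 i (i - (m + 2)) (by omega), g2 (i + 1) (i - (m + 2) + 1) (by omega)]
      exact hadj _ (by omega)
  have gnc : ∀ i, i + 1 < m + 1 + (m + 2) → ¬ G.ColliderAt (g i) (g (i + 1)) (g (i + 2)) := by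
    intro i hi
    rcases lt_trichotomy i (m + 1) with h | rfl | h
    · rcases Nat.lt_or_ge i m with h' | h'
      · rw [g1 i (by omega), g1 (i + 1) (by omega), g1 (i + 2) (by omega)]
        exact hnc i h'
      · obtain rfl : i = m := by omega
        rw [g1 i (by omega), g1 (i + 1) (by omega), g2 (i + 2) 0 (by omega)]
        exact hlst
    · rw [g1 (m + 1) le_rfl, g2 _ 0 (by omega), g2 _ 1 (by omega)]
      exact hfst
    · rw [g2 i (i - (m + 2)) (by omega), g2 (i + 1) (i - (m + 2) + 1) (by omega),
        g2 (i + 2) (i - (m + 2) + 2) (by omega)]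
      exact hnc _ (by omega)
  have key : ∀ i, i ≤ m + 1 → ¬ G.arrow (g i) (g (i + 1)) := by
    intro i hi har
    have hd := hG.dir_of_arrow_of_not_arrow har (gadj (i + 1) (by omega))
      fun h => gnc i (by omega) ⟨har, h⟩
    have := (hG.anc_of_noncolliders (f := fun j => g (i + 1 + j)) (n := m + 1)
      (fun j hj => gadj _ (by omega)) (fun j hj => gnc _ (by omega)) hd m le_rfl).2
    rw [g2 (i + 1 + (m + 1)) i (by omega), ← g1 i hi] at this
    exact hG.1 _ _ har this
  constructor
  · intro i hi
    have := key i (by omega)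
    rwa [g1 i (by omega), g1 (i + 1) (by omega)] at this
  · have := key (m + 1) le_rfl
    rwa [g1 (m + 1) le_rfl, g2 _ 0 (by omega)] at this

/-- All edges of a cycle without colliders are undirected. -/
theorem IsAncestral.not_arrow_of_cycle (hG : G.IsAncestral) {m : ℕ} {f : ℕ → V}
    (hadj : ∀ i, i < m + 1 → G.skel.Adj (f i) (f (i + 1))) (hclose : G.skel.Adj (f (m + 1)) (f 0))
    (hnc : ∀ i, i + 1 ≤ m → ¬ G.ColliderAt (f i) (f (i + 1)) (f (i + 2)))
    (hfst : ¬ G.ColliderAt (f (m + 1)) (f 0) (f 1))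
    (hlst : ¬ G.ColliderAt (f m) (f (m + 1)) (f 0)) :
    (∀ i, i < m + 1 → ¬ G.arrow (f i) (f (i + 1)) ∧ ¬ G.arrow (f (i + 1)) (f i)) ∧
      ¬ G.arrow (f (m + 1)) (f 0) ∧ ¬ G.arrow (f 0) (f (m + 1)) := by
  have h := hG.not_arrow_of_cycle_aux hadj hclose hnc hfst hlst
  -- The reversed cycle gives the marks at the opposite ends.
  have h' := hG.not_arrow_of_cycle_aux (m := m) (f := fun i => f (m + 1 - i))
    (fun i hi => by
      have := hadj (m - i) (by omega)
      rw [show m - i + 1 = m + 1 - i by omega, show m - i = m + 1 - (i + 1) by omega] at this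
      exact this.symm)
    (by simpa using hclose.symm)
    (fun i hi => by
      have := hnc (m - (i + 1)) (by omega)
      rw [show m - (i + 1) + 1 = m + 1 - (i + 1) by omega,
        show m - (i + 1) + 2 = m + 1 - i by omega,
        show m - (i + 1) = m + 1 - (i + 2) by omega, colliderAt_comm] at this
      exact this)
    (by simpa [colliderAt_comm] using fun h => hlst h)
    (by
      rw [colliderAt_comm]
      simpa using hfst)
  refine ⟨fun i hi => ⟨h.1 i hi, ?_⟩, h.2, by simpa using h'.2⟩
  have := h'.1 (m - i) (by omega)
  rwa [show m + 1 - (m - i) = i + 1 by omega, show m + 1 - (m - i + 1) = i by omega] at this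

/-! ### Edge marks and soundness of the FCI rules. -/

/-- The edge `x, y` has the mark `m` at the end `y`. -/
def HasMark (G : MixedGraph V) : EndMark → V → V → Prop
  | .arrow, x, y => G.arrow x y
  | .tail, x, y => G.skel.Adj x y ∧ ¬ G.arrow x y

/-- The marks at the last inner node `b` of a discriminating path, and at the next node `c`. -/
theorem IsAncestral.marks_of_discriminating (hG : G.IsAncestral) {sep : V → V → Finset V}
    (hsep : ∀ x y, x ≠ y → ¬ G.skel.Adj x y → G.Sep x y (sep x y)) {q b c : V}
    {p : G.skel.Walk q b} (hp : p.IsPath) (hc : c ∉ p.support) (hl : 2 ≤ p.length)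
    (hbc : G.skel.Adj b c) (hqc : ¬ G.skel.Adj q c)
    (h₁ : ∀ i, i + 2 ≤ p.length → G.arrow (p.getVert i) (p.getVert (i + 1)))
    (h₂ : ∀ i, i + 2 ≤ p.length → G.arrow (p.getVert (i + 2)) (p.getVert (i + 1)))
    (h₃ : ∀ i, i + 2 ≤ p.length → ¬ G.arrow c (p.getVert (i + 1)))
    (h₄ : ∀ i, i + 2 ≤ p.length → G.arrow (p.getVert (i + 1)) c) :
    (b ∈ sep q c → ¬ G.arrow c b ∧ G.arrow b c) ∧
    (b ∉ sep q c → G.arrow p.penultimate b ∧ G.arrow b p.penultimate ∧ G.arrow b c ∧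
      G.arrow c b) := by
  have hcv : ∀ i, p.getVert i ≠ c := fun i h => hc (h ▸ p.getVert_mem_support i)
  have hqc' : q ≠ c := fun h => hcv 0 (by rw [p.getVert_zero, h])
  obtain ⟨k, hk⟩ : ∃ k, p.length = k + 2 := ⟨p.length - 2, by omega⟩
  have hb : p.getVert (k + 2) = b := by rw [← hk, p.getVert_length]
  have hpen : p.penultimate = p.getVert (k + 1) := by
    rw [SimpleGraph.Walk.penultimate, hk]
    rfl
  have hmem := mem_iff_of_discriminating (G := G) (S := sep q c) (k := k + 1) (f := p.getVert)
    (c := c) (by rw [show k + 1 + 1 = p.length by omega]; exact hp.getVert_injOn)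
    (fun i _ => hcv i) (fun i hi => p.adj_getVert_succ (by omega)) (by rwa [hb])
    (fun i hi => ⟨h₁ i (by omega), h₂ i (by omega)⟩)
    (fun i hi => ⟨h₄ i (by omega), h₃ i (by omega)⟩)
    (by rw [p.getVert_zero]; exact hsep q c hqc' hqc)
  rw [show k + 1 + 1 = k + 2 by omega, hb] at hmem
  rw [hpen]
  have hbv := h₂ k (by omega)
  rw [hb] at hbv
  have hvc : G.Dir (p.getVert (k + 1)) c := ⟨h₄ k (by omega), h₃ k (by omega)⟩
  constructor
  · intro hin
    have hnc := hmem.1 hin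
    by_cases har : G.arrow (p.getVert (k + 1)) b
    · have hcb : ¬ G.arrow c b := fun h => hnc ⟨har, h⟩
      exact ⟨hcb, (hG.dir_of_arrow_of_not_arrow har hbc hcb).1⟩
    -- Here `b → v → c` for the node `v` before `b`, so an arrowhead at `b` would close a cycle. An
    -- undirected edge is excluded by the arrowhead of `v → c` at `c`.
    · have hcb : ¬ G.arrow c b := fun h => hG.1 _ _ h (.head ⟨hbv, har⟩ (.single hvc))
      refine ⟨hcb, ?_⟩
      by_contra hn
      exact hG.2 b c _ ⟨hbc, hn, hcb⟩ hvc.1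
  · intro hout
    have hcol : G.ColliderAt (p.getVert (k + 1)) b c := by
      by_contra h
      exact hout (hmem.2 h)
    refine ⟨hcol.1, hbv, ?_, hcol.2⟩
    by_contra hn
    exact hG.1 _ _ hbv (.head hvc (.single ⟨hcol.2, hn⟩))

end MixedGraph

theorem FCIDerived.hasMark {V : Type u} {G : MixedGraph V} (hG : G.IsAncestral)
    {sep : V → V → Finset V} {col noncol : V → V → V → Prop}
    (hsep : ∀ x y, x ≠ y → ¬ G.skel.Adj x y → G.Sep x y (sep x y))
    (hcol : ∀ x y z, col x y z → G.ColliderAt x y z)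
    (hnon : ∀ x y z, noncol x y z → G.skel.Adj x y ∧ G.skel.Adj y z ∧ ¬ G.ColliderAt x y z)
    {m : EndMark} {x y : V} (h : FCIDerived G.skel sep col noncol m x y) : G.HasMark m x y := by
  induction h with
  | colLeft a b c h => exact (hcol a b c h).1
  | colRight a b c h => exact (hcol a b c h).2
  | r1Tail a b c _ h ih =>
    obtain ⟨-, hbc, hc⟩ := hnon a b c h
    exact ⟨hbc.symm, fun har => hc ⟨ih, har⟩⟩
  | r1Arrow a b c _ h ih =>
    obtain ⟨-, hbc, hc⟩ := hnon a b c h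
    exact (hG.dir_of_arrow_of_not_arrow ih hbc fun har => hc ⟨ih, har⟩).1
  -- Without the arrowhead at `c`, the edge is `c → a`, closing a forbidden cycle, or undirected at
  -- a node that has an arrowhead.
  | r2Left a b c _ _ _ hac ih₁ ih₂ ih₃ =>
    by_contra hn
    by_cases har : G.arrow c a
    · exact hG.1 _ _ ih₃ (.head ⟨har, hn⟩ (.single ⟨ih₂, ih₁.2⟩))
    · exact hG.2 a c b ⟨hac, hn, har⟩ ih₃
  | r2Right a b c _ _ _ hac ih₁ ih₂ ih₃ =>
    by_contra hn
    by_cases har : G.arrow c a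
    · exact hG.1 _ _ ih₁ (.head ⟨ih₃, ih₂.2⟩ (.single ⟨har, hn⟩))
    · exact hG.2 a c b ⟨hac, hn, har⟩ ih₃
  | r3 a b c d _ _ h hdb ih₁ ih₂ =>
    obtain ⟨had, hdc, hc⟩ := hnon a d c h
    by_contra hn
    have hbd := hG.dir_of_arrow_of_not_arrow ih₁ hdb.symm hn
    -- If `b → d`, a tail at `d` towards `a` or `c` would give a directed path from `b` to that
    -- node, whose edge to `b` has an arrowhead at `b`. So `d` would be a collider.
    refine hc ⟨?_, ?_⟩ <;> by_contra har
    · exact hG.1 _ _ ih₁ (.head hbd (.single (hG.dir_of_arrow_of_not_arrow hbd.1 had.symm har)))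
    · exact hG.1 _ _ ih₂ (.head hbd (.single (hG.dir_of_arrow_of_not_arrow hbd.1 hdc har)))
  | r4In q b c p m x y hp hc hl hbc hqc _ _ _ _ hin hm ih₁ ih₂ ih₃ ih₄ =>
    obtain ⟨ht, ha⟩ := (hG.marks_of_discriminating hsep hp hc hl hbc hqc ih₁ ih₂
      (fun i hi => (ih₃ i hi).2) ih₄).1 hin
    rcases hm with ⟨rfl, rfl, rfl⟩ | ⟨rfl, rfl, rfl⟩
    · exact ⟨hbc.symm, ht⟩
    · exact ha
  | r4Out q b c p x y hp hc hl hbc hqc _ _ _ _ hout hxy ih₁ ih₂ ih₃ ih₄ =>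
    obtain ⟨h₁, h₂, h₃, h₄⟩ := (hG.marks_of_discriminating hsep hp hc hl hbc hqc ih₁ ih₂
      (fun i hi => (ih₃ i hi).2) ih₄).2 hout
    rcases hxy with ⟨rfl, rfl⟩ | ⟨rfl, rfl⟩ | ⟨rfl, rfl⟩ | ⟨rfl, rfl⟩ <;> assumption
  | r5 a b p x y hp hab hunc hfst hlst hxy =>
    obtain ⟨-, -, hfst⟩ := hnon _ _ _ hfst
    obtain ⟨-, -, hlst⟩ := hnon _ _ _ hlst
    obtain ⟨k, hk⟩ : ∃ k, p.length = k + 1 := by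
      refine ⟨p.length - 1, ?_⟩
      have : p.length ≠ 0 := fun h0 => hab.ne (SimpleGraph.Walk.eq_of_length_eq_zero h0)
      omega
    have hb : p.getVert (k + 1) = b := by rw [← hk, p.getVert_length]
    have hpen : p.penultimate = p.getVert k := by
      rw [SimpleGraph.Walk.penultimate, hk]
      rfl
    obtain ⟨hedge, hba, hab'⟩ := hG.not_arrow_of_cycle (m := k) (f := p.getVert)
      (fun i hi => p.adj_getVert_succ (by omega)) (by rw [hb, p.getVert_zero]; exact hab.symm)
      (fun i hi => (hnon _ _ _ (hunc i (by omega))).2.2)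
      (by rw [hb, p.getVert_zero]; exact fun h => hfst h.symm)
      (by rw [hb, p.getVert_zero, ← hpen]; exact fun h => hlst h.symm)
    rw [hb, p.getVert_zero] at hba hab'
    rcases hxy with hxy | hxy
    · refine ⟨p.adj_of_mem_edges hxy, ?_⟩
      obtain ⟨i, hi, he⟩ := List.getElem_of_mem hxy
      rw [SimpleGraph.Walk.length_edges] at hi
      rw [SimpleGraph.Walk.getElem_edges] at he
      have := hedge i (by omega)
      rcases Sym2.eq_iff.1 he with ⟨rfl, rfl⟩ | ⟨rfl, rfl⟩
      · exact this.1
      · exact this.2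
    · rcases Sym2.eq_iff.1 hxy with ⟨rfl, rfl⟩ | ⟨rfl, rfl⟩
      · exact ⟨hab, hab'⟩
      · exact ⟨hab.symm, hba⟩
  | r6 a b c _ _ hbc ih₁ ih₂ => exact ⟨hbc.symm, hG.2 a b c ⟨ih₁.1, ih₁.2, ih₂.2⟩⟩
  | r7 a b c _ h ih =>
    obtain ⟨hab, hbc, hc⟩ := hnon a b c h
    exact ⟨hbc.symm, fun har => hG.2 a b c ⟨hab, fun h => hc ⟨h, har⟩, ih.2⟩ har⟩
  | r8 a b c _ _ _ _ ih₁ ih₂ ih₃ ih₄ =>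
    refine ⟨(G.arrow_adj _ _ ih₄).symm, fun har => ?_⟩
    by_cases hab : G.arrow a b
    · exact hG.1 _ _ har (.head ⟨hab, ih₁.2⟩ (.single ⟨ih₃, ih₂.2⟩))
    · exact hG.2 b a c ⟨ih₁.1, ih₁.2, hab⟩ har
  | r9 a c p _ hp hunc h ih =>
    obtain ⟨hadj, -, hc⟩ := hnon _ _ _ h
    have hac := G.arrow_adj _ _ ih
    -- An arrowhead at `a` from `c` makes the first edge of `p` leave `a`; having no colliders, `p`
    -- is then directed to `c`.
    refine ⟨hac.symm, fun har => hG.1 _ _ har (hG.anc_of_walk p ?_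
      (fun i hi => (hnon _ _ _ (hunc i hi)).2.2) ?_)⟩
    · exact Nat.pos_of_ne_zero fun h0 => hac.ne (SimpleGraph.Walk.eq_of_length_eq_zero h0)
    · exact hG.dir_of_arrow_of_not_arrow har hadj.symm fun h => hc ⟨h, har⟩
  | r10 a b c d p q _ _ _ _ _ hp hq huncp huncq h ih₁ ih₂ ih₃ ih₄ ih₅ =>
    obtain ⟨hadj, hadj', hc⟩ := hnon _ _ _ h
    have hac := G.arrow_adj _ _ ih₁
    have aux : ∀ {e : V} (r : G.skel.Walk a e), G.skel.Adj a (r.getVert 1) → 0 < r.length := by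
      intro e r hr
      refine Nat.pos_of_ne_zero fun h0 => hr.ne ?_
      rw [r.getVert_of_length_le (by omega), SimpleGraph.Walk.eq_of_length_eq_zero h0]
    refine ⟨hac.symm, fun har => ?_⟩
    -- As `a` is a non-collider between the two paths, one of them leaves `a` at a tail. With an
    -- arrowhead at `a` from `c`, that path is directed and continues into `c`.
    by_cases h₁ : G.arrow (p.getVert 1) a
    · have := hG.anc_of_walk q (aux q hadj') (fun i hi => (hnon _ _ _ (huncq i hi)).2.2)
        (hG.dir_of_arrow_of_not_arrow har hadj' fun h => hc ⟨h₁, h⟩)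
      exact hG.1 _ _ har (this.tail ⟨ih₅, ih₄.2⟩)
    · have := hG.anc_of_walk p (aux p hadj.symm) (fun i hi => (hnon _ _ _ (huncp i hi)).2.2)
        (hG.dir_of_arrow_of_not_arrow har hadj.symm h₁)
      exact hG.1 _ _ har (this.tail ⟨ih₃, ih₂.2⟩)

/-! ### Runs without marks -/

theorem PCRun.skel_eq {V : Type u} [Finite V] {rule : TripleRule} {useSep : Bool} {L : TestLog V}
    {sep : V → V → Finset V} {out : OutGraph V} (h : PCRun rule useSep L sep out)
    {G : MixedGraph V} (hG : G.IsDAG) (hL : G.Represents L) : out.skel = G.skel := by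
  have hle : ∀ x y, G.skel.Adj x y → out.skel.Adj x y := fun x y hxy => by
    by_contra hn
    exact hL.not_adj_of_ind (h.deleted x y hxy.ne hn) hxy
  -- The parents of `y` are neighbours of `y` in the output, so their set has been tested; it would
  -- separate a surplus edge.
  have aux : ∀ x y, out.skel.Adj x y → ¬ G.skel.Adj x y → G.Anc y x := fun x y hxy hn => by
    by_contra hanc
    refine hL.not_sep_of_dep (h.exhausted y x hxy.symm ({a | G.Dir a y}.toFinite.toFinset) ?_)
      (hG.sep_of_parents hanc hn (fun a ha => by simpa using ha) fun s hs => ?_).symm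
    · intro s hs
      have hs : G.Dir s y := by simpa using hs
      have hadj := G.arrow_adj _ _ hs.1
      exact ⟨(hle _ _ hadj).symm, by rintro rfl; exact hn hadj⟩
    · exact hG.not_anc (by simpa using hs)
  ext x y
  refine ⟨fun hxy => ?_, hle x y⟩
  by_contra hn
  rcases hG.not_anc_or_not_anc hxy.ne with hanc | hanc
  · exact hanc (aux x y hxy hn)
  · exact hanc (aux y x hxy.symm fun h => hn h.symm)

theorem PCRun.not_marked {V : Type u} [Finite V] {rule : TripleRule} {useSep : Bool}
    {L : TestLog V} {sep : V → V → Finset V} {out : OutGraph V}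
    (h : PCRun rule useSep L sep out) {G : MixedGraph V} (hG : G.IsDAG) (hL : G.Represents L) :
    ¬ (out.HasConflict ∨ out.HasAmbiguity) := by
  have hskel := h.skel_eq hG hL
  have hind : ∀ {x y z}, Unshielded out.skel x y z → L.Ind x z (sep x z) := fun hu =>
    h.deleted _ _ hu.2.2.1 hu.2.2.2
  -- The parents of one outer node form a candidate set that separates in `G`; having been tested,
  -- it tested independent and is consulted.
  have hcand : ∀ {x y z}, rule ≠ .standard → Unshielded out.skel x y z →
      ∃ S, L.Ind x z S ∧ S ∈ nbrCand out.skel x z := fun {x y z} hr hu => by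
    have hn : ¬ G.skel.Adj x z := hskel ▸ hu.2.2.2
    have aux : ∀ x z, ¬ G.Anc z x → ¬ G.skel.Adj x z →
        ∃ S : Finset V, G.Sep x z S ∧ ∀ s ∈ S, out.skel.Adj z s := fun x z hanc hn => by
      refine ⟨({a | G.Dir a z}.toFinite.toFinset),
        hG.sep_of_parents hanc hn (fun a ha => by simpa using ha) fun s hs => ?_, fun s hs => ?_⟩
      · exact hG.not_anc (by simpa using hs)
      · have hs : G.Dir s z := by simpa using hs
        rw [hskel]
        exact (G.arrow_adj _ _ hs.1).symm
    rcases hG.not_anc_or_not_anc hu.2.2.1 with hanc | hanc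
    · obtain ⟨S, hS, hS'⟩ := aux x z hanc hn
      have hc : S ∈ nbrCand out.skel x z := .inr hS'
      exact ⟨S, hL.ind_of_tested (h.consult hr x y z hu S hc) hS, hc⟩
    · obtain ⟨S, hS, hS'⟩ := aux z x hanc fun h => hn h.symm
      have hc : S ∈ nbrCand out.skel x z := .inl hS'
      exact ⟨S, hL.ind_of_tested (h.consult hr x y z hu S hc) hS.symm, hc⟩
  rintro (hc | ⟨x, y, z, ha⟩)
  · refine h.orient.not_hasConflict hG hskel (fun _ _ => False.elim) ?_ ?_ hc
    · rintro x y z ⟨hu, hs⟩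
      have hi := hind hu
      rw [hskel] at hu
      exact hs.colliderAt hL hu.1 hu.2.1 hu.2.2.1 hi
    · rintro x y z ⟨hu, hs⟩
      have hi := hind hu
      rw [hskel] at hu
      exact ⟨hu.1, hu.2.1, hs.not_colliderAt hL hu.1 hu.2.1 hu.2.2.1 hi⟩
  · obtain ⟨hu, h₁, h₂⟩ := (h.ambiguous_iff x y z).1 ha
    have := TripleRule.says_of_represents (rule := rule) (useSep := useSep)
      (cand := nbrCand out.skel) hL (hskel ▸ hu.1) (hskel ▸ hu.2.1) hu.2.2.1 (hind hu)
      (Set.toFinite _) fun hr => (hcand hr hu).imp fun S hS => ⟨hS.1, .inl hS.2⟩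
    exact this.elim h₁ h₂

theorem FCIRun.skel_eq {V : Type u} [Finite V] {rule : TripleRule} {L : TestLog V}
    {C₁ : SimpleGraph V} {sep : V → V → Finset V} {out : OutGraph V}
    (h : FCIRun rule L C₁ sep out) {G : MixedGraph V} (hG : G.IsMAG) (hL : G.Represents L) :
    out.skel = G.skel := by
  have hle : ∀ x y, G.skel.Adj x y → out.skel.Adj x y := fun x y hxy => by
    by_contra hn
    exact hL.not_adj_of_ind (h.deleted x y hxy.ne hn) hxy
  ext x y
  refine ⟨fun hxy => ?_, hle x y⟩
  by_contra hn
  obtain ⟨S, hS, hS'⟩ := hG.exists_sep_of_not_adj hxy.ne hn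
  refine hL.not_sep_of_dep (h.exhausted x y hxy S fun s hs => ?_) hS
  -- It remains to see that the collider path to `s` is a Possible-D-SEP path in `C₁`.
  obtain ⟨hsx, hsy, n, f, rfl, rfl, hinj, hadj, hcol⟩ := hS' s hs
  refine ⟨⟨hsx.symm, ?_⟩, hsy⟩
  obtain ⟨p, hl, hv⟩ := C₁.exists_walk_of_seq n f fun i hi => h.skel_le (hle _ _ (hadj i hi))
  refine ⟨p, ?_, fun i hi => ?_⟩
  · rw [← SimpleGraph.Walk.IsPath.getVert_injOn_iff, hl]
    intro i hi j hj hij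
    exact hinj hi hj (by rwa [hv i hi, hv j hj] at hij)
  · rw [hl] at hi
    rw [hv i (by omega), hv (i + 1) (by omega), hv (i + 2) hi, or_iff_not_imp_left]
    intro hC
    have hne : f i ≠ f (i + 2) := fun he => by
      have := hinj (show i ≤ n by omega) (show i + 2 ≤ n by omega) he
      omega
    have hxy := hadj i (by omega)
    have hyz := hadj (i + 1) (by omega)
    -- An unshielded collider of `G` is outside the recorded separating set, so the preliminary
    -- collider rule finds it.
    have hnot : f (i + 1) ∉ sep (f i) (f (i + 2)) := fun hmem =>
      (MixedGraph.mem_iff_not_colliderAt_of_sep hxy hyz hne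
        (hL.sep_of_ind (h.deleted _ _ hne fun ho => hC (h.skel_le ho)))).1 hmem (hcol i hi)
    have hxy' := h.skel_le (hle _ _ hxy)
    have hyz' := h.skel_le (hle _ _ hyz)
    exact ⟨⟨_, ⟨hxy', hyz', hne, hC⟩, hnot⟩,
      ⟨_, ⟨hyz'.symm, hxy'.symm, hne.symm, fun h => hC h.symm⟩, h.sep_symm _ _ ▸ hnot⟩⟩

theorem FCIRun.not_marked {V : Type u} [Finite V] {rule : TripleRule} {L : TestLog V}
    {C₁ : SimpleGraph V} {sep : V → V → Finset V} {out : OutGraph V}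
    (h : FCIRun rule L C₁ sep out) {G : MixedGraph V} (hG : G.IsMAG) (hL : G.Represents L) :
    ¬ (out.HasConflict ∨ out.HasAmbiguity) := by
  have hskel := h.skel_eq hG hL
  have hind : ∀ {x y z}, Unshielded out.skel x y z → L.Ind x z (sep x z) := fun hu =>
    h.deleted _ _ hu.2.2.1 hu.2.2.2
  rintro (⟨x, y, -, hh, ht⟩ | ⟨x, y, z, ha⟩)
  · obtain ⟨A, -, hA, hhead, htail⟩ := h.orient
    have hmark : ∀ m x y, A m x y → G.HasMark m x y := fun m x y hm => by
      have hd := hA m x y hm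
      -- The classifications are made opaque so that rewriting the skeleton leaves them alone.
      generalize hcol : (fun x y z => Unshielded out.skel x y z ∧
        rule.SaysCollider (rule.consulted true L sep (nbrCand out.skel) x z) y) = col at hd
      generalize hnon : (fun x y z => Unshielded out.skel x y z ∧
        rule.SaysNoncollider (rule.consulted true L sep (nbrCand out.skel) x z) y) = noncol at hd
      rw [hskel] at hd
      refine hd.hasMark hG.1 (fun x y hne hn => hL.sep_of_ind (h.deleted x y hne (hskel ▸ hn)))
        ?_ ?_
      · rintro x y z hc
        obtain ⟨hu, hs⟩ := hcol ▸ hc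
        have hi := hind hu
        rw [hskel] at hu
        exact hs.colliderAt hL hu.1 hu.2.1 hu.2.2.1 hi
      · rintro x y z hc
        obtain ⟨hu, hs⟩ := hnon ▸ hc
        have hi := hind hu
        rw [hskel] at hu
        exact ⟨hu.1, hu.2.1, hs.not_colliderAt hL hu.1 hu.2.1 hu.2.2.1 hi⟩
    exact (hmark _ _ _ ((htail x y).1 ht)).2 (hmark _ _ _ ((hhead x y).1 hh))
  · obtain ⟨hu, h₁, h₂⟩ := (h.ambiguous_iff x y z).1 ha
    -- The recorded set is itself consulted, which supplies non-emptiness.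
    have := TripleRule.says_of_represents (rule := rule) (useSep := true)
      (cand := nbrCand out.skel) hL (hskel ▸ hu.1) (hskel ▸ hu.2.1) hu.2.2.1 (hind hu)
      (Set.toFinite _) fun _ => ⟨_, hind hu, .inr ⟨rfl, rfl⟩⟩
    exact this.elim h₁ h₂

/-! ### Stationary time series DAGs and PCMCI+. -/

section TimeSeries

variable {I : Type u} {τ : ℕ} {G : MixedGraph (I × ℤ)}

theorem time_le_of_dir (hG : G ∈ tsDags I τ) {x y : I × ℤ} (h : G.Dir x y) :
    x.2 ≤ y.2 ∧ y.2 - x.2 ≤ τ :=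
  hG.2.1 x.1 y.1 x.2 y.2 h.1

theorem time_le_of_anc (hG : G ∈ tsDags I τ) {x y : I × ℤ} (h : G.Anc x y) : x.2 ≤ y.2 := by
  induction h with
  | refl => exact le_rfl
  | tail _ h ih => exact ih.trans (time_le_of_dir hG h).1

theorem lag_le_of_adj (hG : G ∈ tsDags I τ) {x y : I × ℤ} (h : G.skel.Adj x y) :
    |y.2 - x.2| ≤ (τ : ℤ) := by
  rw [abs_le]
  rcases hG.1.1 x y h with hd | hd <;> have := time_le_of_dir hG hd <;> omega

/-- Picks the node whose parents should separate: the later one, or for equal times the one that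
acyclicity allows. Tests take contemporaneous conditions at that node. -/
theorem le_and_not_anc_or (hG : G ∈ tsDags I τ) {x y : I × ℤ} (hne : x ≠ y) :
    (x.2 ≤ y.2 ∧ ¬ G.Anc y x) ∨ (y.2 ≤ x.2 ∧ ¬ G.Anc x y) := by
  rcases lt_trichotomy x.2 y.2 with h | h | h
  · exact .inl ⟨h.le, fun ha => absurd (time_le_of_anc hG ha) (by omega)⟩
  · exact (hG.1.not_anc_or_not_anc hne).imp (fun h' => ⟨h.le, h'⟩) fun h' => ⟨h.ge, h'⟩
  · exact .inr ⟨h.le, fun ha => absurd (time_le_of_anc hG ha) (by omega)⟩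

/-- `S` consists of the contemporaneous parents of `y`; the lagged ones are in `B y`. The remaining
lagged conditions precede `y` in time and so are non-descendants, which conditioning on parents
tolerates. -/
theorem exists_isMCISet_sep [Finite I] (hG : G ∈ tsDags I τ) {B : I × ℤ → Finset (I × ℤ)}
    (hB : ∀ x y, x ∈ B y → x.2 < y.2) {x y : I × ℤ}
    (hpa : ∀ a, G.Dir a y → a.2 < y.2 → a ∈ B y) (hxy : x.2 ≤ y.2) (hanc : ¬ G.Anc y x)
    (hadj : ¬ G.skel.Adj x y) :
    ∃ S S' : Finset (I × ℤ), (∀ s ∈ S, G.Dir s y ∧ s.2 = y.2) ∧ IsMCISet B x y S S' ∧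
      G.Sep x y S' := by
  classical
  have hfin : {s : I × ℤ | G.Dir s y ∧ s.2 = y.2}.Finite := by
    refine (Set.finite_range fun i : I => (i, y.2)).subset ?_
    rintro ⟨i, t⟩ ⟨-, rfl⟩
    exact ⟨i, rfl⟩
  refine ⟨hfin.toFinset, hfin.toFinset ∪ (B y \ {x}) ∪ B x, fun s hs => by simpa using hs, ?_,
    hG.1.sep_of_parents hanc hadj (fun a ha => ?_) fun s hs => ?_⟩
  · simp [IsMCISet, Set.union_assoc]
  · have hax : a ≠ x := by
      rintro rfl
      exact hadj (G.arrow_adj _ _ ha.1)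
    rcases (time_le_of_dir hG ha).1.eq_or_lt with h | h
    · simp [ha, h]
    · simp [hpa a ha h, hax]
  · simp only [Finset.mem_union, Finset.mem_sdiff, Set.Finite.mem_toFinset, Set.mem_ofPred_eq] at hs
    rcases hs with (hs | hs) | hs
    · exact hG.1.not_anc hs.1
    · have := hB _ _ hs.1
      exact fun ha => absurd (time_le_of_anc hG ha) (by omega)
    · have := hB _ _ hs
      exact fun ha => absurd (time_le_of_anc hG ha) (by omega)

/-- The node set may be infinite, but candidates only use two time slices and the lagged conditions.
The majority count depends on this. -/
theorem mciCand_finite [Finite I] (C : SimpleGraph (I × ℤ)) (B : I × ℤ → Finset (I × ℤ))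
    (x z : I × ℤ) : (mciCand C B x z).Finite := by
  have hW : ((Set.range fun i : I => (i, z.2)) ∪ (Set.range fun i : I => (i, x.2)) ∪
      ↑(B x) ∪ ↑(B z) : Set (I × ℤ)).Finite :=
    (((Set.finite_range _).union (Set.finite_range _)).union (B x).finite_toSet).union
      (B z).finite_toSet
  refine (hW.toFinset.powerset.finite_toSet).subset ?_
  rintro S' ⟨S, hS⟩
  rw [Finset.mem_coe, Finset.mem_powerset]
  intro v hv
  rw [Set.Finite.mem_toFinset]
  rcases hS with ⟨-, hS, hM⟩ | ⟨-, hS, hM⟩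
  all_goals
    have hv' : v ∈ (S' : Set (I × ℤ)) := hv
    rw [hM] at hv'
    rcases hv' with (hv' | hv') | hv'
  · exact .inl (.inl (.inl ⟨v.1, Prod.ext rfl (hS v hv').2.symm⟩))
  · exact .inr hv'.1
  · exact .inl (.inr hv')
  · exact .inl (.inl (.inr ⟨v.1, Prod.ext rfl (hS v hv').2.symm⟩))
  · exact .inl (.inr hv'.1)
  · exact .inr hv'

variable {rule : TripleRule} {useSep : Bool} {L : TestLog (I × ℤ)} {B : I × ℤ → Finset (I × ℤ)}
  {sep : I × ℤ → I × ℤ → Finset (I × ℤ)} {out : OutGraph (I × ℤ)}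

theorem PCMCIPlusRun.mem_lagged (h : PCMCIPlusRun τ rule useSep L B sep out)
    (hG : G ∈ tsDags I τ) (hL : G.Represents L) {a y : I × ℤ} (ha : G.Dir a y)
    (hlt : a.2 < y.2) : a ∈ B y := by
  by_contra hn
  obtain ⟨S, hS⟩ := h.lagged_removed a y hlt (time_le_of_dir hG ha).2 hn
  exact hL.not_adj_of_ind hS (G.arrow_adj _ _ ha.1)

theorem PCMCIPlusRun.skel_eq [Finite I] (h : PCMCIPlusRun τ rule useSep L B sep out)
    (hG : G ∈ tsDags I τ) (hL : G.Represents L) : out.skel = G.skel := by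
  have hle : ∀ x y, G.skel.Adj x y → out.skel.Adj x y := fun x y hxy => by
    by_contra hn
    exact hL.not_adj_of_ind (h.deleted x y hxy.ne (lag_le_of_adj hG hxy) hn) hxy
  have aux : ∀ x y, out.skel.Adj x y → x.2 ≤ y.2 → ¬ G.Anc y x → G.skel.Adj x y := by
    intro x y hxy ht hanc
    by_contra hn
    obtain ⟨S, S', hS, hM, hs⟩ := exists_isMCISet_sep hG (fun a b hab => (h.lagged_mem a b hab).1)
      (fun a ha hlt => h.mem_lagged hG hL ha hlt) ht hanc hn
    refine hL.not_sep_of_dep (h.exhausted x y hxy ht S S' (fun s hs => ?_) hM) hs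
    have hadj := G.arrow_adj _ _ (hS s hs).1.1
    exact ⟨(hle _ _ hadj).symm, (hS s hs).2, by rintro rfl; exact hn hadj⟩
  ext x y
  refine ⟨fun hxy => ?_, hle x y⟩
  rcases le_and_not_anc_or hG hxy.ne with ⟨ht, ha⟩ | ⟨ht, ha⟩
  · exact aux x y hxy ht ha
  · exact (aux y x hxy.symm ht ha).symm

theorem PCMCIPlusRun.not_marked [Finite I] (h : PCMCIPlusRun τ rule useSep L B sep out)
    (hG : G ∈ tsDags I τ) (hL : G.Represents L) : ¬ (out.HasConflict ∨ out.HasAmbiguity) := by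
  have hskel := h.skel_eq hG hL
  have hind : ∀ {x y z}, TsUnshielded out.skel x y z → L.Ind x z (sep x z) := fun {x y z} hu => by
    -- Only lags up to `τ` are tested. One edge of the triple is contemporaneous, so `x` and `z`
    -- have the lag of the other edge.
    refine h.deleted _ _ hu.1.2.2.1 ?_ hu.1.2.2.2
    have h₁ := abs_le.1 (h.skel_lag x y hu.1.1)
    have h₂ := abs_le.1 (h.skel_lag y z hu.1.2.1)
    rw [abs_le]
    rcases hu.2 with hu | hu <;> omega
  have hcand : ∀ {x y z}, rule ≠ .standard → TsUnshielded out.skel x y z →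
      ∃ S, L.Ind x z S ∧ S ∈ mciCand out.skel B x z := fun {x y z} hr hu => by
    have hn : ¬ G.skel.Adj x z := hskel ▸ hu.1.2.2.2
    have aux : ∀ x z, x.2 ≤ z.2 → ¬ G.Anc z x → ¬ G.skel.Adj x z →
        ∃ S S' : Finset (I × ℤ), (∀ s ∈ S, out.skel.Adj z s ∧ s.2 = z.2) ∧
          IsMCISet B x z S S' ∧ G.Sep x z S' := fun x z ht hanc hn => by
      obtain ⟨S, S', hS, hM, hs⟩ := exists_isMCISet_sep hG
        (fun a b hab => (h.lagged_mem a b hab).1) (fun a ha hlt => h.mem_lagged hG hL ha hlt)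
        ht hanc hn
      refine ⟨S, S', fun s hs => ⟨?_, (hS s hs).2⟩, hM, hs⟩
      rw [hskel]
      exact (G.arrow_adj _ _ (hS s hs).1.1).symm
    rcases le_and_not_anc_or hG hu.1.2.2.1 with ⟨ht, hanc⟩ | ⟨ht, hanc⟩
    · obtain ⟨S, S', hS, hM, hs⟩ := aux x z ht hanc hn
      have hc : S' ∈ mciCand out.skel B x z := ⟨S, .inl ⟨ht, hS, hM⟩⟩
      exact ⟨S', hL.ind_of_tested (h.consult hr x y z hu S' hc) hs, hc⟩
    · obtain ⟨S, S', hS, hM, hs⟩ := aux z x ht hanc fun h => hn h.symm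
      have hc : S' ∈ mciCand out.skel B x z := ⟨S, .inr ⟨ht, hS, hM⟩⟩
      exact ⟨S', hL.ind_of_tested (h.consult hr x y z hu S' hc) hs.symm, hc⟩
  rintro (hc | ⟨x, y, z, ha⟩)
  · refine h.orient.not_hasConflict hG.1 hskel ?_ ?_ ?_ hc
    · rintro x y ⟨hadj, hlt⟩
      rw [hskel] at hadj
      -- The time order known beforehand is correct in `G`, whose edges never point backwards.
      refine hG.1.dir_of_not_arrow hadj fun har => ?_
      have := (time_le_of_dir hG (hG.1.dir_of_arrow har)).1
      omega
    · rintro x y z ⟨hu, hs⟩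
      exact hs.colliderAt hL (hskel ▸ hu.1.1) (hskel ▸ hu.1.2.1) hu.1.2.2.1 (hind hu)
    · rintro x y z ⟨hu, hs⟩
      have hxy : G.skel.Adj x y := hskel ▸ hu.1.1
      have hyz : G.skel.Adj y z := hskel ▸ hu.1.2.1
      exact ⟨hxy, hyz, hs.not_colliderAt hL hxy hyz hu.1.2.2.1 (hind hu)⟩
  · obtain ⟨hu, h₁, h₂⟩ := (h.ambiguous_iff x y z).1 ha
    have := TripleRule.says_of_represents (rule := rule) (useSep := useSep)
      (cand := mciCand out.skel B) hL (hskel ▸ hu.1.1) (hskel ▸ hu.1.2.1) hu.1.2.2.1 (hind hu)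
      (mciCand_finite _ _ _ _) fun hr => (hcand hr hu).imp fun S hS => ⟨hS.1, .inl hS.2⟩
    exact this.elim h₁ h₂

end TimeSeries

theorem PCLikeOutput.not_represents {V : Type u} {𝒢 : Set (MixedGraph V)} {L : TestLog V}
    {out : OutGraph V} (hrun : PCLikeOutput 𝒢 L out)
    (hmark : out.HasConflict ∨ out.HasAmbiguity) : ∀ G ∈ 𝒢, ¬ G.Represents L := by
  intro G hG hL
  cases hrun with
  | pc rule useSep L sep out h => exact h.not_marked hG hL hmark
  | fci rule L C₁ sep out h => exact h.not_marked hG hL hmark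
  | pcmciPlus τ rule useSep L B sep out h => exact h.not_marked hG hL hmark

theorem corollary1 {V : Type u} (𝒢 : Set (MixedGraph V)) (L : TestLog V) (out : OutGraph V)
    (hrun : PCLikeOutput 𝒢 L out) (hmark : out.HasConflict ∨ out.HasAmbiguity) :
    (∀ G ∈ 𝒢, ¬ G.Represents L) ∧
      ∀ R : OutGraph V, out.IsResolution 𝒢 R → R.Incoherent 𝒢 L := by
  have hrep := hrun.not_represents hmark
  refine ⟨hrep, ?_⟩
  rintro R ⟨-, -, -, H, hH, hdesc⟩
  by_contra hc
  simp only [OutGraph.Incoherent, not_or, not_not] at hc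
  -- Coherence transfers every result to the described graph `H`, contradicting the first part.
  exact hrep H hH ⟨fun t ht => (hc.1 ht).2 H hH hdesc, fun t ht => (hc.2 ht).2 H hH hdesc⟩
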